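/- **Coherence for normal (op)lax functors.** A lax functor of bicategories $F\colon \mathcal C\to\mathcal D$, with unit constraints $i\colon I_{F(A)}\to F(I_A)$ and composition constraints $m\colon F(X)\odot F(Y)\to F(X\odot Y)$, is *normal* if every $i$ is an isomorphism; an oplax functor (with constraints in the opposite directions) is *normal* if its unit constraints are isomorphisms. For a directed graph $G$, let $\mathcal B(G)$ be the free bicategory on $G$ (with respect to strict functors), and let $\Phi_G\colon \mathcal B(G)\to \mathcal N(G)$ be the free normal lax functor on $G$. Explicitly, the 0-cells of $\mathcal N(G)$ are the vertices of $G$; its 1-cells are the parenthesized composites of formal units and of terms $\Phi_G(W)$ with $W$ a 1-cell of $\mathcal B(G)$; its 2-cells are generated under composition and whiskering by the associators and unitors of $\mathcal N(G)$ and their inverses, the cells $\Phi_G(\eta)$ for 2-cells $\eta$ of $\mathcal B(G)$, the unit constraints $i$ and their formal inverses, and the composition constraints $m$, subject to the axioms of a bicategory, the axioms of a lax functor, and the invertibility of $i$. The free normal oplax functor is defined in the same way with the constraints reversed. Let $U\mathcal C$ be the underlying graph (0-cells and 1-cells) of a bicategory $\mathcal C$. For every normal lax functor $F\colon\mathcal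 C\to\mathcal D$ there is a unique strict functor $\hat F\colon \mathcal N(U\mathcal C)\to\mathcal D$ whose composite with $\Phi_{U\mathcal C}$ is the composite of $F$ with the evaluation functor $\mathcal B(U\mathcal C)\to\mathcal C$. A *formal diagram* for $F$ is a diagram of 2-cells in $\mathcal D$ that lifts along $\hat F$ to a diagram of 2-cells in $\mathcal N(U\mathcal C)$; formal diagrams for a normal oplax functor are defined in the same way from the free normal oplax functor. **Theorem.** Let $F$ be a normal lax functor or a normal oplax functor between bicategories. Then every formal diagram for $F$ commutes: any two parallel paths of 2-cells in the diagram have the same composite. -/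

import Mathlib

open CategoryTheory Bicategory

universe w w₁ w₂ v v₁ v₂ v₃ u u₁ u₂ u₃

/-! ### Normal lax and normal oplax functors -/

/-- A lax functor of bicategories is normal if its unit constraints `𝟙 (F a) ⟶ F (𝟙 a)` are
invertible. -/
class CategoryTheory.LaxFunctor.IsNormal {C : Type u₁} [Bicategory.{w₁, v₁} C] {D : Type u₂}
    [Bicategory.{w₂, v₂} D] (F : C ⥤ᴸ D) : Prop where
  isIso_mapId : ∀ a : C, IsIso (F.mapId a)

/-- An oplax functor of bicategories is normal if its unit constraints `F (𝟙 a) ⟶ 𝟙 (F a)` are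
invertible. -/
class CategoryTheory.OplaxFunctor.IsNormal {C : Type u₁} [Bicategory.{w₁, v₁} C] {D : Type u₂}
    [Bicategory.{w₂, v₂} D] (F : C ⥤ᵒᵖᴸ D) : Prop where
  isIso_mapId : ∀ a : C, IsIso (F.mapId a)

attribute [instance] LaxFunctor.IsNormal.isIso_mapId OplaxFunctor.IsNormal.isIso_mapId

/-- The inverse of the unit constraint of a normal lax functor. -/
noncomputable def CategoryTheory.LaxFunctor.mapIdInv {C : Type u₁} [Bicategory.{w₁, v₁} C]
    {D : Type u₂} [Bicategory.{w₂, v₂} D] (F : C ⥤ᴸ D) [F.IsNormal] (a : C) :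
    F.map (𝟙 a) ⟶ 𝟙 (F.obj a) :=
  inv (F.mapId a)

/-- The inverse of the unit constraint of a normal oplax functor. -/
noncomputable def CategoryTheory.OplaxFunctor.mapIdInv {C : Type u₁} [Bicategory.{w₁, v₁} C]
    {D : Type u₂} [Bicategory.{w₂, v₂} D] (F : C ⥤ᵒᵖᴸ D) [F.IsNormal] (a : C) :
    𝟙 (F.obj a) ⟶ F.map (𝟙 a) :=
  inv (F.mapId a)

theorem CategoryTheory.LaxFunctor.ext_of_prelax {C : Type u₁} [Bicategory.{w₁, v₁} C] {D : Type u₂}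
    [Bicategory.{w₂, v₂} D] {F G : C ⥤ᴸ D} (h : F.toPrelaxFunctor = G.toPrelaxFunctor)
    (h₀ : ∀ a, F.mapId a ≍ G.mapId a)
    (h₁ : ∀ {a b c : C} (f : a ⟶ b) (g : b ⟶ c), F.mapComp f g ≍ G.mapComp f g) : F = G := by
  rcases F with ⟨P, i, m⟩
  rcases G with ⟨Q, j, n⟩
  obtain rfl : P = Q := h
  obtain rfl : @i = @j := funext fun a => eq_of_heq (h₀ a)
  obtain rfl : @m = @n := by
    funext a b c f g
    exact eq_of_heq (h₁ f g)
  rfl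

theorem CategoryTheory.OplaxFunctor.ext_of_prelax {C : Type u₁} [Bicategory.{w₁, v₁} C] {D : Type u₂}
    [Bicategory.{w₂, v₂} D] {F G : C ⥤ᵒᵖᴸ D} (h : F.toPrelaxFunctor = G.toPrelaxFunctor)
    (h₀ : ∀ a, F.mapId a ≍ G.mapId a)
    (h₁ : ∀ {a b c : C} (f : a ⟶ b) (g : b ⟶ c), F.mapComp f g ≍ G.mapComp f g) : F = G := by
  rcases F with ⟨P, i, m⟩
  rcases G with ⟨Q, j, n⟩
  obtain rfl : P = Q := h
  obtain rfl : @i = @j := funext fun a => eq_of_heq (h₀ a)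
  obtain rfl : @m = @n := by
    funext a b c f g
    exact eq_of_heq (h₁ f g)
  rfl

/-! ### Bicategories presented by generators and relations -/

namespace FormalBicat

section Cells

variable {Q : Type u} [Quiver.{v} Q]

/-- Formal composites of edges of a graph `Q`: binary trees whose leaves are edges or formal units.
These are the 1-cells of the free bicategory on `Q`. -/
abbrev Word (a b : Q) : Type (max u v) := FreeBicategory.Hom a b

abbrev Word.id (a : Q) : Word a a := FreeBicategory.Hom.id a

/-- Formal composites and whiskerings of associators, unitors, and generating 2-cells `Γ`. -/
inductive Cell (Γ : ∀ a b : Q, Word a b → Word a b → Type (max u v)) :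
    ∀ {a b : Q}, Word a b → Word a b → Type (max u v)
  | gen {a b : Q} {f g : Word a b} (x : Γ a b f g) : Cell Γ f g
  | id {a b : Q} (f : Word a b) : Cell Γ f f
  | vcomp {a b : Q} {f g h : Word a b} (η : Cell Γ f g) (θ : Cell Γ g h) : Cell Γ f h
  | whiskerLeft {a b c : Q} (f : Word a b) {g h : Word b c} (η : Cell Γ g h) :
      Cell Γ (f.comp g) (f.comp h)
  | whiskerRight {a b c : Q} {f g : Word a b} (h : Word b c) (η : Cell Γ f g) :
      Cell Γ (f.comp h) (g.comp h)
  | associator {a b c d : Q} (f : Word a b) (g : Word b c) (h : Word c d) :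
      Cell Γ ((f.comp g).comp h) (f.comp (g.comp h))
  | associatorInv {a b c d : Q} (f : Word a b) (g : Word b c) (h : Word c d) :
      Cell Γ (f.comp (g.comp h)) ((f.comp g).comp h)
  | leftUnitor {a b : Q} (f : Word a b) : Cell Γ ((Word.id a).comp f) f
  | leftUnitorInv {a b : Q} (f : Word a b) : Cell Γ f ((Word.id a).comp f)
  | rightUnitor {a b : Q} (f : Word a b) : Cell Γ (f.comp (.id b)) f
  | rightUnitorInv {a b : Q} (f : Word a b) : Cell Γ f (f.comp (.id b))

/-- The relations between formal 2-cells which hold in every bicategory in which the relations `R`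
hold. -/
inductive CellRel {Γ : ∀ a b : Q, Word a b → Word a b → Type (max u v)}
    (R : ∀ (a b : Q) (f g : Word a b), Cell Γ f g → Cell Γ f g → Prop) :
    ∀ {a b : Q} {f g : Word a b}, Cell Γ f g → Cell Γ f g → Prop
  | of {a b : Q} {f g : Word a b} {η θ : Cell Γ f g} : R a b f g η θ → CellRel R η θ
  | vcomp_right {a b : Q} {f g h : Word a b} (η : Cell Γ f g) (θ₁ θ₂ : Cell Γ g h) :
      CellRel R θ₁ θ₂ → CellRel R (.vcomp η θ₁) (.vcomp η θ₂)
  | vcomp_left {a b : Q} {f g h : Word a b} (η₁ η₂ : Cell Γ f g) (θ : Cell Γ g h) :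
      CellRel R η₁ η₂ → CellRel R (.vcomp η₁ θ) (.vcomp η₂ θ)
  | id_comp {a b : Q} {f g : Word a b} (η : Cell Γ f g) : CellRel R (.vcomp (.id f) η) η
  | comp_id {a b : Q} {f g : Word a b} (η : Cell Γ f g) : CellRel R (.vcomp η (.id g)) η
  | assoc {a b : Q} {f g h i : Word a b} (η : Cell Γ f g) (θ : Cell Γ g h) (ι : Cell Γ h i) :
      CellRel R (.vcomp (.vcomp η θ) ι) (.vcomp η (.vcomp θ ι))
  | whisker_left {a b c : Q} (f : Word a b) (g h : Word b c) (η η' : Cell Γ g h) :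
      CellRel R η η' → CellRel R (.whiskerLeft f η) (.whiskerLeft f η')
  | whisker_left_id {a b c : Q} (f : Word a b) (g : Word b c) :
      CellRel R (.whiskerLeft f (.id g)) (.id (f.comp g))
  | whisker_left_comp {a b c : Q} (f : Word a b) {g h i : Word b c} (η : Cell Γ g h)
      (θ : Cell Γ h i) :
      CellRel R (.whiskerLeft f (.vcomp η θ)) (.vcomp (.whiskerLeft f η) (.whiskerLeft f θ))
  | id_whisker_left {a b : Q} {f g : Word a b} (η : Cell Γ f g) :
      CellRel R (.whiskerLeft (.id a) η) (.vcomp (.leftUnitor f) (.vcomp η (.leftUnitorInv g)))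
  | comp_whisker_left {a b c d : Q} (f : Word a b) (g : Word b c) {h h' : Word c d}
      (η : Cell Γ h h') :
      CellRel R (.whiskerLeft (f.comp g) η) (.vcomp (.associator f g h)
        (.vcomp (.whiskerLeft f (.whiskerLeft g η)) (.associatorInv f g h')))
  | whisker_right {a b c : Q} (f g : Word a b) (h : Word b c) (η η' : Cell Γ f g) :
      CellRel R η η' → CellRel R (.whiskerRight h η) (.whiskerRight h η')
  | id_whisker_right {a b c : Q} (f : Word a b) (g : Word b c) :
      CellRel R (.whiskerRight g (.id f)) (.id (f.comp g))
  | comp_whisker_right {a b c : Q} {f g h : Word a b} (i : Word b c) (η : Cell Γ f g)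
      (θ : Cell Γ g h) :
      CellRel R (.whiskerRight i (.vcomp η θ)) (.vcomp (.whiskerRight i η) (.whiskerRight i θ))
  | whisker_right_id {a b : Q} {f g : Word a b} (η : Cell Γ f g) :
      CellRel R (.whiskerRight (.id b) η) (.vcomp (.rightUnitor f) (.vcomp η (.rightUnitorInv g)))
  | whisker_right_comp {a b c d : Q} {f f' : Word a b} (g : Word b c) (h : Word c d)
      (η : Cell Γ f f') :
      CellRel R (.whiskerRight (g.comp h) η) (.vcomp (.associatorInv f g h)
        (.vcomp (.whiskerRight h (.whiskerRight g η)) (.associator f' g h)))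
  | whisker_assoc {a b c d : Q} (f : Word a b) {g g' : Word b c} (η : Cell Γ g g')
      (h : Word c d) :
      CellRel R (.whiskerRight h (.whiskerLeft f η)) (.vcomp (.associator f g h)
        (.vcomp (.whiskerLeft f (.whiskerRight h η)) (.associatorInv f g' h)))
  | whisker_exchange {a b c : Q} {f g : Word a b} {h i : Word b c} (η : Cell Γ f g)
      (θ : Cell Γ h i) :
      CellRel R (.vcomp (.whiskerLeft f θ) (.whiskerRight i η))
        (.vcomp (.whiskerRight h η) (.whiskerLeft g θ))
  | associator_hom_inv {a b c d : Q} (f : Word a b) (g : Word b c) (h : Word c d) :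
      CellRel R (.vcomp (.associator f g h) (.associatorInv f g h)) (.id ((f.comp g).comp h))
  | associator_inv_hom {a b c d : Q} (f : Word a b) (g : Word b c) (h : Word c d) :
      CellRel R (.vcomp (.associatorInv f g h) (.associator f g h)) (.id (f.comp (g.comp h)))
  | left_unitor_hom_inv {a b : Q} (f : Word a b) :
      CellRel R (.vcomp (.leftUnitor f) (.leftUnitorInv f)) (.id ((Word.id a).comp f))
  | left_unitor_inv_hom {a b : Q} (f : Word a b) :
      CellRel R (.vcomp (.leftUnitorInv f) (.leftUnitor f)) (.id f)
  | right_unitor_hom_inv {a b : Q} (f : Word a b) :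
      CellRel R (.vcomp (.rightUnitor f) (.rightUnitorInv f)) (.id (f.comp (.id b)))
  | right_unitor_inv_hom {a b : Q} (f : Word a b) :
      CellRel R (.vcomp (.rightUnitorInv f) (.rightUnitor f)) (.id f)
  | pentagon {a b c d e : Q} (f : Word a b) (g : Word b c) (h : Word c d) (i : Word d e) :
      CellRel R (.vcomp (.whiskerRight i (.associator f g h))
          (.vcomp (.associator f (g.comp h) i) (.whiskerLeft f (.associator g h i))))
        (.vcomp (.associator (f.comp g) h i) (.associator f g (h.comp i)))
  | triangle {a b c : Q} (f : Word a b) (g : Word b c) :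
      CellRel R (.vcomp (.associator f (.id b) g) (.whiskerLeft f (.leftUnitor g)))
        (.whiskerRight g (.rightUnitor f))

end Cells

/-- A presentation of a bicategory whose 0-cells and generating 1-cells are those of a graph `Q`:
generating 2-cells and relations. -/
structure Presentation (Q : Type u) [Quiver.{v} Q] where
  Gen : ∀ a b : Q, Word a b → Word a b → Type (max u v)
  Rel : ∀ (a b : Q) (f g : Word a b), Cell Gen f g → Cell Gen f g → Prop

namespace Presentation

variable {Q : Type u} [Quiver.{v} Q]

/-- The 0-cells of the presented bicategory: the vertices of `Q`. -/
def Bicat (_P : Presentation Q) : Type u := Q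

variable (P : Presentation Q)

instance categoryStruct : CategoryStruct.{max u v} P.Bicat where
  Hom := fun a b : Q => Word a b
  id := fun a : Q => Word.id a
  comp := @fun _ _ _ f g => FreeBicategory.Hom.comp f g

/-- The 2-cells of the presented bicategory: formal 2-cells modulo the relations. -/
instance homCategory (a b : P.Bicat) : Category.{max u v} (a ⟶ b) where
  Hom f g := Quot (@CellRel Q _ P.Gen P.Rel a b f g)
  id f := Quot.mk _ (Cell.id f)
  comp := @fun _ _ _ => Quot.map₂ Cell.vcomp CellRel.vcomp_right CellRel.vcomp_left
  id_comp := by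
    rintro f g ⟨η⟩
    exact Quot.sound (CellRel.id_comp η)
  comp_id := by
    rintro f g ⟨η⟩
    exact Quot.sound (CellRel.comp_id η)
  assoc := by
    rintro f g h i ⟨η⟩ ⟨θ⟩ ⟨ι⟩
    exact Quot.sound (CellRel.assoc η θ ι)

instance bicategory : Bicategory.{max u v, max u v} (P.Bicat) where
  homCategory := @fun a b => homCategory P a b
  whiskerLeft := @fun _ _ _ f g h η => Quot.map (Cell.whiskerLeft f) (CellRel.whisker_left f g h) η
  whiskerLeft_id := @fun _ _ _ f g => Quot.sound (CellRel.whisker_left_id f g)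
  associator := @fun _ _ _ _ f g h =>
    { hom := Quot.mk _ (Cell.associator f g h)
      inv := Quot.mk _ (Cell.associatorInv f g h)
      hom_inv_id := Quot.sound (CellRel.associator_hom_inv f g h)
      inv_hom_id := Quot.sound (CellRel.associator_inv_hom f g h) }
  leftUnitor := @fun _ _ f =>
    { hom := Quot.mk _ (Cell.leftUnitor f)
      inv := Quot.mk _ (Cell.leftUnitorInv f)
      hom_inv_id := Quot.sound (CellRel.left_unitor_hom_inv f)
      inv_hom_id := Quot.sound (CellRel.left_unitor_inv_hom f) }
  rightUnitor := @fun _ _ f =>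
    { hom := Quot.mk _ (Cell.rightUnitor f)
      inv := Quot.mk _ (Cell.rightUnitorInv f)
      hom_inv_id := Quot.sound (CellRel.right_unitor_hom_inv f)
      inv_hom_id := Quot.sound (CellRel.right_unitor_inv_hom f) }
  whiskerLeft_comp := by
    rintro a b c f g h i ⟨η⟩ ⟨θ⟩
    exact Quot.sound (CellRel.whisker_left_comp f η θ)
  id_whiskerLeft := by
    rintro a b f g ⟨η⟩
    exact Quot.sound (CellRel.id_whisker_left η)
  comp_whiskerLeft := by
    rintro a b c d f g h h' ⟨η⟩
    exact Quot.sound (CellRel.comp_whisker_left f g η)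
  whiskerRight := @fun _ _ _ f g η h => Quot.map (Cell.whiskerRight h) (CellRel.whisker_right f g h) η
  id_whiskerRight := @fun _ _ _ f g => Quot.sound (CellRel.id_whisker_right f g)
  comp_whiskerRight := by
    rintro a b c f g h ⟨η⟩ ⟨θ⟩ i
    exact Quot.sound (CellRel.comp_whisker_right i η θ)
  whiskerRight_id := by
    rintro a b f g ⟨η⟩
    exact Quot.sound (CellRel.whisker_right_id η)
  whiskerRight_comp := by
    rintro a b c d f f' ⟨η⟩ g h
    exact Quot.sound (CellRel.whisker_right_comp g h η)
  whisker_assoc := by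
    rintro a b c d f g g' ⟨η⟩ h
    exact Quot.sound (CellRel.whisker_assoc f η h)
  whisker_exchange := by
    rintro a b c f g h i ⟨η⟩ ⟨θ⟩
    exact Quot.sound (CellRel.whisker_exchange η θ)
  pentagon := @fun _ _ _ _ _ f g h i => Quot.sound (CellRel.pentagon f g h i)
  triangle := @fun _ _ _ f g => Quot.sound (CellRel.triangle f g)

section Eval

variable {P} {D : Type u₂} [Bicategory.{w₂, v₂} D] (φ : Q ⥤q D)
  (γ : ∀ {a b : Q} {f g : Word a b}, P.Gen a b f g →
    (FreeBicategory.liftHom φ f ⟶ FreeBicategory.liftHom φ g))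

/-- Evaluation of formal 2-cells in a bicategory `D`, given values for the generators. -/
def evalCell : ∀ {a b : Q} {f g : Word a b}, Cell P.Gen f g →
    (FreeBicategory.liftHom φ f ⟶ FreeBicategory.liftHom φ g)
  | _, _, _, _, .gen x => γ x
  | _, _, _, _, .id f => 𝟙 (FreeBicategory.liftHom φ f)
  | _, _, _, _, .vcomp η θ => evalCell η ≫ evalCell θ
  | _, _, _, _, .whiskerLeft f η => FreeBicategory.liftHom φ f ◁ evalCell η
  | _, _, _, _, .whiskerRight h η => evalCell η ▷ FreeBicategory.liftHom φ h
  | _, _, _, _, .associator _ _ _ => (α_ _ _ _).hom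
  | _, _, _, _, .associatorInv _ _ _ => (α_ _ _ _).inv
  | _, _, _, _, .leftUnitor _ => (λ_ _).hom
  | _, _, _, _, .leftUnitorInv _ => (λ_ _).inv
  | _, _, _, _, .rightUnitor _ => (ρ_ _).hom
  | _, _, _, _, .rightUnitorInv _ => (ρ_ _).inv

theorem evalCell_congr (hγ : ∀ {a b : Q} {f g : Word a b} {η θ : Cell P.Gen f g}, P.Rel a b f g η θ →
      evalCell φ γ η = evalCell φ γ θ)
    {a b : Q} {f g : Word a b} {η θ : Cell P.Gen f g} (H : CellRel P.Rel η θ) :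
    evalCell φ γ η = evalCell φ γ θ := by
  induction H with
  | of h => exact hγ h
  | vcomp_right _ _ _ _ ih => simp only [evalCell, ih]
  | vcomp_left _ _ _ _ ih => simp only [evalCell, ih]
  | whisker_left f _ _ _ _ _ ih => exact congrArg (fun θ => FreeBicategory.liftHom φ f ◁ θ) ih
  | whisker_right _ _ h _ _ _ ih => exact congrArg (fun θ => θ ▷ FreeBicategory.liftHom φ h) ih
  | id_comp η => exact Category.id_comp _
  | comp_id η => exact Category.comp_id _
  | assoc η θ ι => exact Category.assoc _ _ _
  | whisker_left_id f g => exact Bicategory.whiskerLeft_id _ _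
  | whisker_left_comp f η θ => exact Bicategory.whiskerLeft_comp _ _ _
  | id_whisker_left η => exact Bicategory.id_whiskerLeft _
  | comp_whisker_left f g η => exact Bicategory.comp_whiskerLeft _ _ _
  | id_whisker_right f g => exact Bicategory.id_whiskerRight _ _
  | comp_whisker_right i η θ => exact Bicategory.comp_whiskerRight _ _ _
  | whisker_right_id η => exact Bicategory.whiskerRight_id _
  | whisker_right_comp g h η => exact Bicategory.whiskerRight_comp _ _ _
  | whisker_assoc f η h => exact Bicategory.whisker_assoc _ _ _
  | whisker_exchange η θ => exact Bicategory.whisker_exchange _ _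
  | associator_hom_inv f g h => exact Iso.hom_inv_id _
  | associator_inv_hom f g h => exact Iso.inv_hom_id _
  | left_unitor_hom_inv f => exact Iso.hom_inv_id _
  | left_unitor_inv_hom f => exact Iso.inv_hom_id _
  | right_unitor_hom_inv f => exact Iso.hom_inv_id _
  | right_unitor_inv_hom f => exact Iso.inv_hom_id _
  | pentagon f g h i => exact Bicategory.pentagon _ _ _ _
  | triangle f g => exact Bicategory.triangle _ _

/-- The strict functor out of the presented bicategory given by values for the generators which
satisfy the relations. -/
def lift (hγ : ∀ {a b : Q} {f g : Word a b} {η θ : Cell P.Gen f g}, P.Rel a b f g η θ →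
      evalCell φ γ η = evalCell φ γ θ) : StrictPseudofunctor P.Bicat D :=
  StrictPseudofunctor.mk'
    { obj := fun a => φ.obj a
      map := fun f => FreeBicategory.liftHom φ f
      map₂ := fun η => Quot.lift (evalCell φ γ) (fun _ _ H => evalCell_congr φ γ hγ H) η
      map₂_id := fun _ => rfl
      map₂_comp := by
        rintro a b f g h ⟨η⟩ ⟨θ⟩
        rfl
      map_id := fun _ => rfl
      map_comp := fun _ _ => rfl
      map₂_whisker_left := by
        rintro a b c f g g' ⟨η⟩
        exact ((Category.id_comp _).trans (Category.comp_id _)).symm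
      map₂_whisker_right := by
        rintro a b c f f' ⟨η⟩ g
        exact ((Category.id_comp _).trans (Category.comp_id _)).symm
      map₂_left_unitor := fun f => (Category.id_comp _).symm
      map₂_right_unitor := fun f => (Category.id_comp _).symm
      map₂_associator := fun f g h => ((Category.id_comp _).trans (Category.comp_id _)).symm }

end Eval

end Presentation

end FormalBicat

open FormalBicat

/-- The strict functor from the free bicategory on the underlying graph of `C` to `C` which evaluates
formal composites. -/
abbrev counit (C : Type u₁) [Bicategory.{w₁, v₁} C] : FreeBicategory C ⥤ᵖ C :=
  FreeBicategory.lift (Prefunctor.id C)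

/-! ### The free normal lax functor on a graph

For a graph `B`, the free normal lax functor on `B` goes from the free bicategory on `B` to the
bicategory presented as follows.  The 0-cells are the vertices of `B`.  The 1-cells are formal
composites of terms `F(f)`, where `f` is a 1-cell of the free bicategory on `B`. -/

namespace FreeNormalLax

section Construction

variable {B : Type u} [Quiver.{v} B]

/-- The term `F(f)`. -/
abbrev ofHom {a b : FreeBicategory B} (f : a ⟶ b) : Word a b := FreeBicategory.Hom.of f

/-- The generating 2-cells: `F(η)` for 2-cells `η` of the free bicategory, the unit constraints of
`F` and their formal inverses, and the composition constraints of `F`. -/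
inductive Gen : ∀ a b : FreeBicategory B, Word a b → Word a b → Type (max u v)
  | map₂ {a b : FreeBicategory B} {f g : a ⟶ b} (η : f ⟶ g) : Gen _ _ (ofHom f) (ofHom g)
  | mapId (a : FreeBicategory B) : Gen _ _ (.id a) (ofHom (𝟙 a))
  | mapIdInv (a : FreeBicategory B) : Gen _ _ (ofHom (𝟙 a)) (.id a)
  | mapComp {a b c : FreeBicategory B} (f : a ⟶ b) (g : b ⟶ c) :
      Gen _ _ ((ofHom f).comp (ofHom g)) (ofHom (f ≫ g))

/-- The relations: functoriality of `F` on 2-cells, the axioms of a lax functor, and invertibility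
of the unit constraints. -/
inductive Rel : ∀ (a b : FreeBicategory B) (f g : Word a b),
    Cell Gen f g → Cell Gen f g → Prop
  | map₂_id {a b : FreeBicategory B} (f : a ⟶ b) : Rel _ _ _ _ (.gen (.map₂ (𝟙 f))) (.id (ofHom f))
  | map₂_comp {a b : FreeBicategory B} {f g h : a ⟶ b} (η : f ⟶ g) (θ : g ⟶ h) :
      Rel _ _ _ _ (.gen (.map₂ (η ≫ θ))) (.vcomp (.gen (.map₂ η)) (.gen (.map₂ θ)))
  | mapComp_naturality_left {a b c : FreeBicategory B} {f f' : a ⟶ b} (η : f ⟶ f')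
      (g : b ⟶ c) :
      Rel _ _ _ _ (.vcomp (.gen (.mapComp f g)) (.gen (.map₂ (η ▷ g))))
        (.vcomp (.whiskerRight (ofHom g) (.gen (.map₂ η))) (.gen (.mapComp f' g)))
  | mapComp_naturality_right {a b c : FreeBicategory B} (f : a ⟶ b) {g g' : b ⟶ c}
      (η : g ⟶ g') :
      Rel _ _ _ _ (.vcomp (.gen (.mapComp f g)) (.gen (.map₂ (f ◁ η))))
        (.vcomp (.whiskerLeft (ofHom f) (.gen (.map₂ η))) (.gen (.mapComp f g')))
  | map₂_associator {a b c d : FreeBicategory B} (f : a ⟶ b) (g : b ⟶ c) (h : c ⟶ d) :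
      Rel _ _ _ _ (.vcomp (.whiskerRight (ofHom h) (.gen (.mapComp f g)))
          (.vcomp (.gen (.mapComp (f ≫ g) h)) (.gen (.map₂ (α_ f g h).hom))))
        (.vcomp (.associator (ofHom f) (ofHom g) (ofHom h))
          (.vcomp (.whiskerLeft (ofHom f) (.gen (.mapComp g h))) (.gen (.mapComp f (g ≫ h)))))
  | map₂_leftUnitor {a b : FreeBicategory B} (f : a ⟶ b) :
      Rel _ _ _ _ (.gen (.map₂ (λ_ f).inv)) (.vcomp (.leftUnitorInv (ofHom f))
        (.vcomp (.whiskerRight (ofHom f) (.gen (.mapId a))) (.gen (.mapComp (𝟙 a) f))))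
  | map₂_rightUnitor {a b : FreeBicategory B} (f : a ⟶ b) :
      Rel _ _ _ _ (.gen (.map₂ (ρ_ f).inv)) (.vcomp (.rightUnitorInv (ofHom f))
        (.vcomp (.whiskerLeft (ofHom f) (.gen (.mapId b))) (.gen (.mapComp f (𝟙 b)))))
  | mapId_hom_inv (a : FreeBicategory B) :
      Rel _ _ _ _ (.vcomp (.gen (.mapId a)) (.gen (.mapIdInv a))) (.id (.id a))
  | mapId_inv_hom (a : FreeBicategory B) :
      Rel _ _ _ _ (.vcomp (.gen (.mapIdInv a)) (.gen (.mapId a))) (.id (ofHom (𝟙 a)))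

end Construction

end FreeNormalLax

/-- The target of the free normal lax functor on the graph `B`. -/
abbrev FreeNormalLax (B : Type u) [Quiver.{v} B] : Type u :=
  Presentation.Bicat (Q := FreeBicategory B) ⟨FreeNormalLax.Gen, FreeNormalLax.Rel⟩

namespace FreeNormalLax

/-- The free normal lax functor on the graph `B`. -/
def freeLax (B : Type u) [Quiver.{v} B] : FreeBicategory B ⥤ᴸ FreeNormalLax B where
  obj a := a
  map f := ofHom f
  map₂ η := Quot.mk _ (Cell.gen (Gen.map₂ η))
  map₂_id f := Quot.sound (CellRel.of (Rel.map₂_id f))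
  map₂_comp η θ := Quot.sound (CellRel.of (Rel.map₂_comp η θ))
  mapId a := Quot.mk _ (Cell.gen (Gen.mapId a))
  mapComp f g := Quot.mk _ (Cell.gen (Gen.mapComp f g))
  mapComp_naturality_left η g := Quot.sound (CellRel.of (Rel.mapComp_naturality_left η g))
  mapComp_naturality_right f _ _ η := Quot.sound (CellRel.of (Rel.mapComp_naturality_right f η))
  map₂_associator f g h := Quot.sound (CellRel.of (Rel.map₂_associator f g h))
  map₂_leftUnitor f := Quot.sound (CellRel.of (Rel.map₂_leftUnitor f))
  map₂_rightUnitor f := Quot.sound (CellRel.of (Rel.map₂_rightUnitor f))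

instance (B : Type u) [Quiver.{v} B] : (freeLax B).IsNormal where
  isIso_mapId a := ⟨Quot.mk _ (Cell.gen (Gen.mapIdInv a)), Quot.sound (CellRel.of (Rel.mapId_hom_inv a)),
    Quot.sound (CellRel.of (Rel.mapId_inv_hom a))⟩

section Comparison

variable {C : Type u₁} [Bicategory.{w₁, v₁} C] {D : Type u₂} [Bicategory.{w₂, v₂} D]
  (F : C ⥤ᴸ D)

/-- Evaluation of the terms `F(f)` in `D`. -/
def evalAtom : FreeBicategory C ⥤q D where
  obj a := F.obj a
  map f := F.map ((counit C).map f)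

/-- Evaluation of the generating 2-cells in `D`. -/
noncomputable def evalGen [F.IsNormal] : ∀ {a b : FreeBicategory C} {f g : Word a b},
    Gen a b f g → (FreeBicategory.liftHom (evalAtom F) f ⟶ FreeBicategory.liftHom (evalAtom F) g)
  | _, _, _, _, .map₂ η => F.map₂ ((counit C).map₂ η)
  | _, _, _, _, .mapId a => F.mapId a
  | _, _, _, _, .mapIdInv a => F.mapIdInv a
  | _, _, _, _, .mapComp f g => F.mapComp ((counit C).map f) ((counit C).map g)

/-- The strict functor from the target of the free normal lax functor on the underlying graph
of `C` to `D` which is induced by a normal lax functor `F` from `C` to `D`. -/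
noncomputable def comparison [F.IsNormal] : StrictPseudofunctor (FreeNormalLax C) D :=
  Presentation.lift (evalAtom F) (evalGen F) (by
    intro a b f g η θ H
    induction H with
    | map₂_id f => exact (congrArg F.map₂ ((counit C).map₂_id f)).trans (F.map₂_id _)
    | map₂_comp η θ => exact (congrArg F.map₂ ((counit C).map₂_comp η θ)).trans (F.map₂_comp _ _)
    | mapComp_naturality_left η g =>
      rcases η with ⟨η⟩
      exact F.mapComp_naturality_left _ _
    | mapComp_naturality_right f η =>
      rcases η with ⟨η⟩
      exact F.mapComp_naturality_right _ _
    | map₂_associator f g h => exact F.map₂_associator _ _ _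
    | map₂_leftUnitor f => exact F.map₂_leftUnitor _
    | map₂_rightUnitor f => exact F.map₂_rightUnitor _
    | mapId_hom_inv => exact IsIso.hom_inv_id (F.mapId (show C from a))
    | mapId_inv_hom => exact IsIso.inv_hom_id (F.mapId (show C from a)))

/-- The square formed by the free normal lax functor, the counit, `F` and `comparison F`
commutes. -/
theorem free_comp_comparison [F.IsNormal] :
    (freeLax C).comp (comparison F).toLax = (counit C).toLax.comp F := by
  refine LaxFunctor.ext_of_prelax rfl (fun a => ?_) (fun f g => ?_)
  · exact heq_of_eq ((Category.id_comp _).trans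
      ((congrArg _ (F.map₂_id _)).trans (Category.comp_id _)).symm)
  · exact heq_of_eq ((Category.id_comp _).trans
      ((congrArg _ (F.map₂_id _)).trans (Category.comp_id _)).symm)

end Comparison

end FreeNormalLax

/-! ### The free normal oplax functor on a graph

For a graph `B`, the free normal oplax functor on `B` goes from the free bicategory on `B` to the
bicategory presented as follows.  The 0-cells are the vertices of `B`.  The 1-cells are formal
composites of terms `F(f)`, where `f` is a 1-cell of the free bicategory on `B`. -/

namespace FreeNormalOplax

section Construction

variable {B : Type u} [Quiver.{v} B]

/-- The term `F(f)`. -/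
abbrev ofHom {a b : FreeBicategory B} (f : a ⟶ b) : Word a b := FreeBicategory.Hom.of f

/-- The generating 2-cells: `F(η)` for 2-cells `η` of the free bicategory, the unit constraints of
`F` and their formal inverses, and the composition constraints of `F`. -/
inductive Gen : ∀ a b : FreeBicategory B, Word a b → Word a b → Type (max u v)
  | map₂ {a b : FreeBicategory B} {f g : a ⟶ b} (η : f ⟶ g) : Gen _ _ (ofHom f) (ofHom g)
  | mapId (a : FreeBicategory B) : Gen _ _ (ofHom (𝟙 a)) (.id a)
  | mapIdInv (a : FreeBicategory B) : Gen _ _ (.id a) (ofHom (𝟙 a))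
  | mapComp {a b c : FreeBicategory B} (f : a ⟶ b) (g : b ⟶ c) :
      Gen _ _ (ofHom (f ≫ g)) ((ofHom f).comp (ofHom g))

/-- The relations: functoriality of `F` on 2-cells, the axioms of an oplax functor, and invertibility
of the unit constraints. -/
inductive Rel : ∀ (a b : FreeBicategory B) (f g : Word a b),
    Cell Gen f g → Cell Gen f g → Prop
  | map₂_id {a b : FreeBicategory B} (f : a ⟶ b) : Rel _ _ _ _ (.gen (.map₂ (𝟙 f))) (.id (ofHom f))
  | map₂_comp {a b : FreeBicategory B} {f g h : a ⟶ b} (η : f ⟶ g) (θ : g ⟶ h) :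
      Rel _ _ _ _ (.gen (.map₂ (η ≫ θ))) (.vcomp (.gen (.map₂ η)) (.gen (.map₂ θ)))
  | mapComp_naturality_left {a b c : FreeBicategory B} {f f' : a ⟶ b} (η : f ⟶ f')
      (g : b ⟶ c) :
      Rel _ _ _ _ (.vcomp (.gen (.map₂ (η ▷ g))) (.gen (.mapComp f' g)))
        (.vcomp (.gen (.mapComp f g)) (.whiskerRight (ofHom g) (.gen (.map₂ η))))
  | mapComp_naturality_right {a b c : FreeBicategory B} (f : a ⟶ b) {g g' : b ⟶ c}
      (η : g ⟶ g') :
      Rel _ _ _ _ (.vcomp (.gen (.map₂ (f ◁ η))) (.gen (.mapComp f g')))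
        (.vcomp (.gen (.mapComp f g)) (.whiskerLeft (ofHom f) (.gen (.map₂ η))))
  | map₂_associator {a b c d : FreeBicategory B} (f : a ⟶ b) (g : b ⟶ c) (h : c ⟶ d) :
      Rel _ _ _ _ (.vcomp (.gen (.map₂ (α_ f g h).hom))
          (.vcomp (.gen (.mapComp f (g ≫ h))) (.whiskerLeft (ofHom f) (.gen (.mapComp g h)))))
        (.vcomp (.gen (.mapComp (f ≫ g) h)) (.vcomp (.whiskerRight (ofHom h) (.gen (.mapComp f g)))
          (.associator (ofHom f) (ofHom g) (ofHom h))))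
  | map₂_leftUnitor {a b : FreeBicategory B} (f : a ⟶ b) :
      Rel _ _ _ _ (.gen (.map₂ (λ_ f).hom)) (.vcomp (.gen (.mapComp (𝟙 a) f))
        (.vcomp (.whiskerRight (ofHom f) (.gen (.mapId a))) (.leftUnitor (ofHom f))))
  | map₂_rightUnitor {a b : FreeBicategory B} (f : a ⟶ b) :
      Rel _ _ _ _ (.gen (.map₂ (ρ_ f).hom)) (.vcomp (.gen (.mapComp f (𝟙 b)))
        (.vcomp (.whiskerLeft (ofHom f) (.gen (.mapId b))) (.rightUnitor (ofHom f))))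
  | mapId_hom_inv (a : FreeBicategory B) :
      Rel _ _ _ _ (.vcomp (.gen (.mapId a)) (.gen (.mapIdInv a))) (.id (ofHom (𝟙 a)))
  | mapId_inv_hom (a : FreeBicategory B) :
      Rel _ _ _ _ (.vcomp (.gen (.mapIdInv a)) (.gen (.mapId a))) (.id (.id a))

end Construction

end FreeNormalOplax

/-- The target of the free normal oplax functor on the graph `B`. -/
abbrev FreeNormalOplax (B : Type u) [Quiver.{v} B] : Type u :=
  Presentation.Bicat (Q := FreeBicategory B) ⟨FreeNormalOplax.Gen, FreeNormalOplax.Rel⟩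

namespace FreeNormalOplax

/-- The free normal oplax functor on the graph `B`. -/
def freeOplax (B : Type u) [Quiver.{v} B] : FreeBicategory B ⥤ᵒᵖᴸ FreeNormalOplax B where
  obj a := a
  map f := ofHom f
  map₂ η := Quot.mk _ (Cell.gen (Gen.map₂ η))
  map₂_id f := Quot.sound (CellRel.of (Rel.map₂_id f))
  map₂_comp η θ := Quot.sound (CellRel.of (Rel.map₂_comp η θ))
  mapId a := Quot.mk _ (Cell.gen (Gen.mapId a))
  mapComp f g := Quot.mk _ (Cell.gen (Gen.mapComp f g))
  mapComp_naturality_left η g := Quot.sound (CellRel.of (Rel.mapComp_naturality_left η g))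
  mapComp_naturality_right f _ _ η := Quot.sound (CellRel.of (Rel.mapComp_naturality_right f η))
  map₂_associator f g h := Quot.sound (CellRel.of (Rel.map₂_associator f g h))
  map₂_leftUnitor f := Quot.sound (CellRel.of (Rel.map₂_leftUnitor f))
  map₂_rightUnitor f := Quot.sound (CellRel.of (Rel.map₂_rightUnitor f))

instance (B : Type u) [Quiver.{v} B] : (freeOplax B).IsNormal where
  isIso_mapId a := ⟨Quot.mk _ (Cell.gen (Gen.mapIdInv a)), Quot.sound (CellRel.of (Rel.mapId_hom_inv a)),
    Quot.sound (CellRel.of (Rel.mapId_inv_hom a))⟩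

section Comparison

variable {C : Type u₁} [Bicategory.{w₁, v₁} C] {D : Type u₂} [Bicategory.{w₂, v₂} D]
  (F : C ⥤ᵒᵖᴸ D)

/-- Evaluation of the terms `F(f)` in `D`. -/
def evalAtom : FreeBicategory C ⥤q D where
  obj a := F.obj a
  map f := F.map ((counit C).map f)

/-- Evaluation of the generating 2-cells in `D`. -/
noncomputable def evalGen [F.IsNormal] : ∀ {a b : FreeBicategory C} {f g : Word a b},
    Gen a b f g → (FreeBicategory.liftHom (evalAtom F) f ⟶ FreeBicategory.liftHom (evalAtom F) g)
  | _, _, _, _, .map₂ η => F.map₂ ((counit C).map₂ η)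
  | _, _, _, _, .mapId a => F.mapId a
  | _, _, _, _, .mapIdInv a => F.mapIdInv a
  | _, _, _, _, .mapComp f g => F.mapComp ((counit C).map f) ((counit C).map g)

/-- The strict functor from the target of the free normal oplax functor on the underlying graph
of `C` to `D` which is induced by a normal oplax functor `F` from `C` to `D`. -/
noncomputable def comparison [F.IsNormal] : StrictPseudofunctor (FreeNormalOplax C) D :=
  Presentation.lift (evalAtom F) (evalGen F) (by
    intro a b f g η θ H
    induction H with
    | map₂_id f => exact (congrArg F.map₂ ((counit C).map₂_id f)).trans (F.map₂_id _)
    | map₂_comp η θ => exact (congrArg F.map₂ ((counit C).map₂_comp η θ)).trans (F.map₂_comp _ _)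
    | mapComp_naturality_left η g =>
      rcases η with ⟨η⟩
      exact F.mapComp_naturality_left _ _
    | mapComp_naturality_right f η =>
      rcases η with ⟨η⟩
      exact F.mapComp_naturality_right _ _
    | map₂_associator f g h => exact F.map₂_associator _ _ _
    | map₂_leftUnitor f => exact F.map₂_leftUnitor _
    | map₂_rightUnitor f => exact F.map₂_rightUnitor _
    | mapId_hom_inv => exact IsIso.hom_inv_id (F.mapId (show C from a))
    | mapId_inv_hom => exact IsIso.inv_hom_id (F.mapId (show C from a)))

/-- The square formed by the free normal oplax functor, the counit, `F` and `comparison F`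
commutes. -/
theorem free_comp_comparison [F.IsNormal] :
    (freeOplax C).comp (comparison F).toOplax = (counit C).toOplax.comp F := by
  refine OplaxFunctor.ext_of_prelax rfl (fun a => ?_) (fun f g => ?_)
  · exact heq_of_eq ((Category.comp_id _).trans
      ((congrArg (· ≫ _) (F.map₂_id _)).trans (Category.id_comp _)).symm)
  · exact heq_of_eq ((Category.comp_id _).trans
      ((congrArg (· ≫ _) (F.map₂_id _)).trans (Category.id_comp _)).symm)

end Comparison

end FreeNormalOplax

/-! ### Diagrams of 2-cells -/

/-- The category of 1-cells and 2-cells of a bicategory `D`: the disjoint union of the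
hom-categories `D(x, y)`. -/
abbrev TwoCells (D : Type u) [Bicategory.{w, v} D] :=
  Σ p : D × D, (p.1 ⟶ p.2)

/-- The action of a strict functor on 1-cells and 2-cells. -/
def mapTwoCells {B : Type u₁} [Bicategory.{w₁, v₁} B] {D : Type u₂} [Bicategory.{w₂, v₂} D]
    (P : StrictPseudofunctor B D) : TwoCells B ⥤ TwoCells D :=
  Sigma.desc fun p : B × B =>
    P.mapFunctor p.1 p.2 ⋙
      Sigma.incl (C := fun q : D × D => (q.1 ⟶ q.2)) (P.obj p.1, P.obj p.2)

/-- A diagram in a category, indexed by a graph `J`, commutes if any two parallel paths in `J` have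
the same composite. -/
def DiagramCommutes {J : Type u₁} [Quiver.{v₁} J] {E : Type u₂} [Category.{v₂} E]
    (K : J ⥤q E) : Prop :=
  ∀ ⦃i j : J⦄ (p q : Quiver.Path i j), composePath (K.mapPath p) = composePath (K.mapPath q)

/-- A formal diagram for a normal lax functor `F` from `C` to `D`: a diagram of 2-cells in `D` that
lifts along the strict functor to `D` from the target of the free normal lax functor on the
underlying graph of `C`. -/
def CategoryTheory.LaxFunctor.IsFormalDiagram {C : Type u₁} [Bicategory.{w₁, v₁} C] {D : Type u₂}
    [Bicategory.{w₂, v₂} D] (F : C ⥤ᴸ D) [F.IsNormal] {J : Type u₃} [Quiver.{v₃} J]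
    (K : J ⥤q TwoCells D) : Prop :=
  ∃ K' : J ⥤q TwoCells (FreeNormalLax C),
    K' ⋙q (mapTwoCells (FreeNormalLax.comparison F)).toPrefunctor = K

/-- A formal diagram for a normal oplax functor `F` from `C` to `D`: a diagram of 2-cells in `D`
that lifts along the strict functor to `D` from the target of the free normal oplax functor on the
underlying graph of `C`. -/
def CategoryTheory.OplaxFunctor.IsFormalDiagram {C : Type u₁} [Bicategory.{w₁, v₁} C]
    {D : Type u₂} [Bicategory.{w₂, v₂} D] (F : C ⥤ᵒᵖᴸ D) [F.IsNormal] {J : Type u₃}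
    [Quiver.{v₃} J] (K : J ⥤q TwoCells D) : Prop :=
  ∃ K' : J ⥤q TwoCells (FreeNormalOplax C),
    K' ⋙q (mapTwoCells (FreeNormalOplax.comparison F)).toPrefunctor = K

/-! A formal 1-cell is a string of edges divided into terms `F(f)`, together with units and
parentheses. In the lax case the formal 2-cells never change the string. They merge adjacent terms,
create or delete terms without edges, rebracket, or apply 2-cells of the free bicategory, where
parallel 2-cells agree.

Fix a target word `g` and let `K` be the set of positions at which its terms start. Every string has
a normal form relative to `K`: start a new term at each position in `K` and merge everywhere else
(`ofPath`). A word is admissible if no position in `K` is interior to one of its terms. Such a word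
has a map `collapse` to the normal form, built from composition constraints and inverse unit
constraints. Since 2-cells only coarsen the division, admissibility of `g` passes to every word with
a 2-cell to `g` (`Admissible.of_cell`).

By `collapse_naturality`, a 2-cell from `f` to `g` followed by the collapse of `g` is the collapse
of `f` up to a canonical 2-cell between normal forms, which does not depend on the chosen 2-cell. By
`isIso_collapse` the collapse of `g` itself is invertible: its terms with edges are never merged
with one another, and its terms without edges vanish by normality. Cancelling it gives `value_eq`.

This is proved for any normal lax functor on a free bicategory and applied to the composite of `F`
with the evaluation functor. The oplax case follows by reversing the 2-cells of the target (`toCo`),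
because the 2-cells of a free bicategory are invertible. -/

theorem CategoryTheory.FreeBicategory.isIso₂ {B : Type u} [Quiver.{v} B] {a b : FreeBicategory B}
    {f g : a ⟶ b} (η : f ⟶ g) : IsIso η :=
  letI := FreeBicategory.homCategory' (B := B) a b
  -- Normalization is an equivalence onto a discrete category of paths, in which every morphism is
  -- an equality.
  have : IsIso ((FreeBicategory.normalizeEquiv (B := B) a b).functor.map η) :=
    ⟨eqToHom (Discrete.ext (FreeBicategory.normalizeAux_congr .nil η).symm),
      Subsingleton.elim _ _, Subsingleton.elim _ _⟩
  isIso_of_reflects_iso η (FreeBicategory.normalizeEquiv (B := B) a b).functor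

/-- The recursor of formal composites, phrased with `𝟙` and `≫` so that the bicategory API applies
in each case. -/
theorem CategoryTheory.FreeBicategory.hom_induction {B : Type u} [Quiver.{v} B]
    {motive : ∀ {b c : FreeBicategory B}, (b ⟶ c) → Prop}
    (of : ∀ {b c : B} (e : b ⟶ c), motive (FreeBicategory.of.map e))
    (id : ∀ b : FreeBicategory B, motive (𝟙 b))
    (comp : ∀ {b c d : FreeBicategory B} (f : b ⟶ c) (g : c ⟶ d), motive f → motive g →
      motive (f ≫ g))
    {b c : FreeBicategory B} (f : b ⟶ c) : motive f := by
  change @FreeBicategory.Hom B _ b c at f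
  induction f with
  | of e => exact of e
  | id => exact id _
  | comp f g ihf ihg => exact comp f g ihf ihg

/-! ### States: 1-cells with a distinguished last term -/

namespace FreeNormalLax

section Coherence

variable {B : Type u} [Quiver.{v} B] {X : Type u₂} [Bicategory.{w₂, v₂} X]
  (G : FreeBicategory B ⥤ᴸ X)

/-- A 1-cell of `X` of the form `init ≫ G.map last`. -/
structure State (a b : FreeBicategory B) where
  mid : FreeBicategory B
  init : G.obj a ⟶ G.obj mid
  last : mid ⟶ b

namespace State

variable {G} {a b c d : FreeBicategory B}

/-- The 1-cell of `X` represented by a state. -/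
def word (s : State G a b) : G.obj a ⟶ G.obj b := s.init ≫ G.map s.last

/-- Two states with the same initial part are connected by the 2-cells of the free bicategory
between their last terms. -/
inductive Hom : State G a b → State G a b → Type (max u v u₂ v₂)
  | mk (m : FreeBicategory B) (w : G.obj a ⟶ G.obj m) {l l' : m ⟶ b} (η : l ⟶ l') :
      Hom ⟨m, w, l⟩ ⟨m, w, l'⟩

instance : Category (State G a b) where
  Hom := Hom
  id s := .mk s.mid s.init (𝟙 s.last)
  comp := fun | .mk m w η, .mk _ _ θ => .mk m w (η ≫ θ)
  id_comp := by rintro _ _ ⟨m, w, η⟩; exact congrArg (Hom.mk m w) (Category.id_comp η)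
  comp_id := by rintro _ _ ⟨m, w, η⟩; exact congrArg (Hom.mk m w) (Category.comp_id η)
  assoc := by
    rintro _ _ _ _ ⟨m, w, η⟩ ⟨_, _, θ⟩ ⟨_, _, ι⟩
    exact congrArg (Hom.mk m w) (Category.assoc η θ ι)

/-- Morphisms of states inherit thinness from the hom-categories of the free bicategory, since the
middle object and the initial part are fixed. Any two canonical 2-cells between states therefore
agree. -/
instance : Quiver.IsThin (State G a b) := by
  refine fun s t => ⟨?_⟩
  intro h k
  change Hom s t at h k
  rcases h with ⟨m, w, η⟩
  cases k with
  | mk _ _ θ => exact congrArg (Hom.mk m w) (Subsingleton.elim η θ)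

/-- The 2-cell of `X` represented by a morphism of states. -/
def cell : {s t : State G a b} → (s ⟶ t) → (s.word ⟶ t.word)
  | _, _, .mk _ w η => w ◁ G.map₂ η

theorem cell_id (s : State G a b) : cell (𝟙 s) = 𝟙 s.word :=
  (congrArg _ (G.map₂_id _)).trans (Bicategory.whiskerLeft_id _ _)

theorem comp_cell_self {f : G.obj a ⟶ G.obj b} {s : State G a b} (η : f ⟶ s.word) (σ : s ⟶ s) :
    η ≫ cell σ = η := by
  rw [Subsingleton.elim σ (𝟙 s), cell_id, Category.comp_id]

theorem cell_comp {s t r : State G a b} (σ : s ⟶ t) (τ : t ⟶ r) :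
    cell σ ≫ cell τ = cell (σ ≫ τ) := by
  rcases σ with ⟨m, w, η⟩
  rcases τ with ⟨_, _, θ⟩
  exact ((congrArg _ (G.map₂_comp η θ)).trans (Bicategory.whiskerLeft_comp _ _ _)).symm

/-- The 2-cells of the free bicategory are invertible, hence so are the morphisms of states. -/
theorem nonempty_symm {s t : State G a b} (σ : s ⟶ t) : Nonempty (t ⟶ s) := by
  rcases σ with ⟨m, w, η⟩
  have := FreeBicategory.isIso₂ η
  exact ⟨.mk m w (inv η)⟩

/-- Start a new last term. -/
def cut (s : State G a b) (f : b ⟶ c) : State G a c := ⟨b, s.word, f⟩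

/-- Extend the last term. -/
def merge (s : State G a b) (f : b ⟶ c) : State G a c := ⟨s.mid, s.init, s.last ≫ f⟩

def cutMap (s : State G a b) {f g : b ⟶ c} (η : f ⟶ g) : s.cut f ⟶ s.cut g :=
  Hom.mk b s.word η

theorem cell_cutMap (s : State G a b) {f g : b ⟶ c} (η : f ⟶ g) :
    cell (s.cutMap η) = s.word ◁ G.map₂ η := rfl

def mergeMap {s t : State G a b} (σ : s ⟶ t) {f g : b ⟶ c} (η : f ⟶ g) : s.merge f ⟶ t.merge g :=
  match s, t, σ with
  | _, _, .mk m w θ => Hom.mk m w (θ ▷ f ≫ _ ◁ η)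

def mergeUnit (s : State G a b) : s.merge (𝟙 b) ⟶ s :=
  Hom.mk s.mid s.init (ρ_ s.last).hom

def mergeAssoc (s : State G a b) (f : b ⟶ c) (g : c ⟶ d) :
    (s.merge f).merge g ⟶ s.merge (f ≫ g) :=
  Hom.mk s.mid s.init (α_ s.last f g).hom

def mergeAssocInv (s : State G a b) (f : b ⟶ c) (g : c ⟶ d) :
    s.merge (f ≫ g) ⟶ (s.merge f).merge g :=
  Hom.mk s.mid s.init (α_ s.last f g).inv

/-- Both states have initial part `s.word` and last term `f ≫ g`, so the identity connects them. -/
def cutMerge (s : State G a b) (f : b ⟶ c) (g : c ⟶ d) :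
    s.cut (f ≫ g) ⟶ (s.cut f).merge g :=
  Hom.mk b s.word (𝟙 (f ≫ g))

/-- The 2-cell which merges `G.map f` into the last term. -/
def mergeCell (s : State G a b) (f : b ⟶ c) : s.word ≫ G.map f ⟶ (s.merge f).word :=
  (α_ _ _ _).hom ≫ s.init ◁ G.mapComp s.last f

/-- Naturality of the composition constraint in its first argument, whiskered with the initial part.
-/
theorem cell_whiskerRight_mergeCell {s t : State G a b} (σ : s ⟶ t) (f : b ⟶ c) :
    cell σ ▷ G.map f ≫ t.mergeCell f = s.mergeCell f ≫ cell (mergeMap σ (𝟙 f)) := by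
  rcases σ with ⟨m, w, η⟩
  rename_i l l'
  change (w ◁ G.map₂ η) ▷ G.map f ≫ (α_ w (G.map l') (G.map f)).hom ≫ w ◁ G.mapComp l' f =
    ((α_ w (G.map l) (G.map f)).hom ≫ w ◁ G.mapComp l f) ≫ w ◁ G.map₂ (η ▷ f ≫ l' ◁ 𝟙 f)
  rw [Bicategory.whiskerLeft_id, Category.comp_id, Category.assoc,
    ← Bicategory.whiskerLeft_comp w (G.mapComp l f), G.mapComp_naturality_left]
  simp

theorem cell_whiskerRight_mergeCell_assoc {s t : State G a b} (σ : s ⟶ t) (f : b ⟶ c)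
    {g : G.obj a ⟶ G.obj c} (η : (t.merge f).word ⟶ g) :
    cell σ ▷ G.map f ≫ t.mergeCell f ≫ η =
      s.mergeCell f ≫ cell (mergeMap σ (𝟙 f)) ≫ η := by
  rw [← Category.assoc, cell_whiskerRight_mergeCell, Category.assoc]

theorem whiskerLeft_map₂_mergeCell (s : State G a b) {f g : b ⟶ c} (η : f ⟶ g) :
    s.word ◁ G.map₂ η ≫ s.mergeCell g = s.mergeCell f ≫ cell (mergeMap (𝟙 s) η) := by
  rcases s with ⟨m, w, l⟩
  change (w ≫ G.map l) ◁ G.map₂ η ≫ (α_ w (G.map l) (G.map g)).hom ≫ w ◁ G.mapComp l g =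
    ((α_ w (G.map l) (G.map f)).hom ≫ w ◁ G.mapComp l f) ≫ w ◁ G.map₂ (𝟙 l ▷ f ≫ l ◁ η)
  rw [Bicategory.id_whiskerRight, Category.id_comp, Category.assoc,
    ← Bicategory.whiskerLeft_comp w (G.mapComp l f), G.mapComp_naturality_right]
  simp

theorem whiskerLeft_map₂_mergeCell_assoc (s : State G a b) {f g : b ⟶ c} (η : f ⟶ g)
    {h : G.obj a ⟶ G.obj c} (θ : (s.merge g).word ⟶ h) :
    s.word ◁ G.map₂ η ≫ s.mergeCell g ≫ θ = s.mergeCell f ≫ cell (mergeMap (𝟙 s) η) ≫ θ := by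
  rw [← Category.assoc, whiskerLeft_map₂_mergeCell, Category.assoc]

theorem mapComp_cell_cutMerge (s : State G a b) (f : b ⟶ c) (g : c ⟶ d) {t : State G a d}
    (θ : (s.cut f).merge g ⟶ t) :
    s.word ◁ G.mapComp f g ≫ cell (s.cutMerge f g ≫ θ) = (α_ s.word (G.map f) (G.map g)).inv ≫
      (s.cut f).mergeCell g ≫ cell θ := by
  have h : cell (s.cutMerge f g) = 𝟙 _ :=
    (congrArg _ (PrelaxFunctor.map₂_id _ _)).trans (Bicategory.whiskerLeft_id _ _)
  have h' (x : s.word ≫ G.map (f ≫ g) ⟶ t.word) : s.word ◁ G.mapComp f g ≫ x =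
      (α_ s.word (G.map f) (G.map g)).inv ≫
        ((α_ s.word (G.map f) (G.map g)).hom ≫ s.word ◁ G.mapComp f g) ≫ x := by
    rw [Category.assoc, Iso.inv_hom_id_assoc]
  rw [← cell_comp, h]
  exact (congrArg (_ ≫ ·) (Category.id_comp _)).trans (h' (cell θ))

/-- Compatibility of merging with the composition constraints. -/
theorem mergeCell_mergeCell (s : State G a b) (f : b ⟶ c) (g : c ⟶ d) :
    s.mergeCell f ▷ G.map g ≫ (s.merge f).mergeCell g ≫
        cell (s.mergeAssoc f g) =
      (α_ _ _ _).hom ≫ s.word ◁ G.mapComp f g ≫ s.mergeCell (f ≫ g) := by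
  rcases s with ⟨m, w, l⟩
  change ((α_ w (G.map l) (G.map f)).hom ≫ w ◁ G.mapComp l f) ▷ G.map g ≫
      ((α_ w (G.map (l ≫ f)) (G.map g)).hom ≫ w ◁ G.mapComp (l ≫ f) g) ≫
        w ◁ G.map₂ (α_ l f g).hom =
    (α_ (w ≫ G.map l) (G.map f) (G.map g)).hom ≫ (w ≫ G.map l) ◁ G.mapComp f g ≫
      (α_ w (G.map l) (G.map (f ≫ g))).hom ≫ w ◁ G.mapComp l (f ≫ g)
  -- The associativity axiom of `G`, whiskered with the initial part, is the whole content; the rest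
  -- is coherence in `X`.
  have h := congrArg (fun θ => w ◁ θ) (G.map₂_associator l f g)
  simp only [Bicategory.whiskerLeft_comp] at h
  simp only [comp_whiskerRight, whisker_assoc, Category.assoc, Iso.inv_hom_id_assoc, h,
    comp_whiskerLeft]
  simp

/-- Merging an empty term is absorbing a unit constraint. -/
theorem mapId_mergeCell (s : State G a b) :
    s.word ◁ G.mapId b ≫ s.mergeCell (𝟙 b) ≫ cell s.mergeUnit =
    (ρ_ s.word).hom := by
  rcases s with ⟨m, w, l⟩
  change (w ≫ G.map l) ◁ G.mapId b ≫
      ((α_ w (G.map l) (G.map (𝟙 b))).hom ≫ w ◁ G.mapComp l (𝟙 b)) ≫ w ◁ G.map₂ (ρ_ l).hom =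
    (ρ_ (w ≫ G.map l)).hom
  have h := congrArg (fun θ => w ◁ θ) (G.map₂_rightUnitor_hom l)
  simp only [Bicategory.whiskerLeft_comp] at h
  simp only [comp_whiskerLeft, Category.assoc, Iso.inv_hom_id_assoc]
  rw [← h]
  simp

end State

/-! ### Normal forms of edge paths relative to a set of cut positions -/

/-- Paths of edges, seen as paths between the objects of the free bicategory. -/
def EdgePath (a b : FreeBicategory B) : Type max u v := @Quiver.Path B _ a b

namespace EdgePath

variable {a b c : FreeBicategory B}

def length (p : EdgePath a b) : ℕ := @Quiver.Path.length B _ a b p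

/-- Append the edges of a formal composite to a path. -/
def extend (p : EdgePath a b) (f : b ⟶ c) : EdgePath a c := FreeBicategory.normalizeAux p f

theorem extend_congr (p : EdgePath a b) {f g : b ⟶ c} (η : f ⟶ g) : p.extend f = p.extend g :=
  FreeBicategory.normalizeAux_congr p η

end EdgePath

open Classical in
/-- The state obtained from a path of edges by starting a new term at the positions in `K`. -/
noncomputable def ofPath (K : Set ℕ) {a : FreeBicategory B} :
    {b : FreeBicategory B} → EdgePath a b → State G a b
  | _, Quiver.Path.nil => ⟨a, 𝟙 _, 𝟙 a⟩
  | _, Quiver.Path.cons p e =>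
    if EdgePath.length p ∈ K then (ofPath K p).cut (.of e) else (ofPath K p).merge (.of e)

variable {G} {a b c d : FreeBicategory B} {K : Set ℕ}

theorem length_le_extend (p : EdgePath a b) (f : b ⟶ c) :
    p.length ≤ (p.extend f).length := by
  induction f using FreeBicategory.hom_induction with
  | of e => exact Nat.le_succ _
  | id => exact le_rfl
  | comp f g ihf ihg => exact (ihf p).trans (ihg _)

/-- A formal composite without edges is isomorphic to a unit. -/
theorem eq_and_nonempty_of_length_eq (p : EdgePath a b) (f : b ⟶ c)
    (h : (p.extend f).length = p.length) :
    ∃ e : c = b, Nonempty (f ⟶ e ▸ 𝟙 b) := by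
  induction f using FreeBicategory.hom_induction with
  | of e => exact absurd h (Nat.succ_ne_self _)
  | id => exact ⟨rfl, ⟨𝟙 _⟩⟩
  | comp f g ihf ihg =>
    have h₁ := length_le_extend p f
    have h₂ := length_le_extend (p.extend f) g
    change ((p.extend f).extend g).length = _ at h
    obtain ⟨rfl, ⟨η⟩⟩ := ihf p (by omega)
    obtain ⟨rfl, ⟨θ⟩⟩ := ihg (p.extend f) (by omega)
    exact ⟨rfl, ⟨η ▷ g ≫ (λ_ _).hom ≫ θ⟩⟩

/-- With no cut position in the range, `ofPath` merges every edge of `f` one at a time; merging `f`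
at once differs only by a 2-cell of the free bicategory. -/
theorem nonempty_merge_hom (p : EdgePath a b) (f : b ⟶ c)
    (h : ∀ j, p.length ≤ j → j < (p.extend f).length → j ∉ K) :
    Nonempty ((ofPath G K p).merge f ⟶ ofPath G K (p.extend f)) := by
  induction f using FreeBicategory.hom_induction with
  | of e =>
    exact ⟨eqToHom (if_neg (h _ le_rfl (Nat.lt_succ_self _))).symm⟩
  | id => exact ⟨(ofPath G K p).mergeUnit⟩
  | comp f g ihf ihg =>
    have h₁ := length_le_extend p f
    have h₂ := length_le_extend (p.extend f) g
    obtain ⟨σ⟩ := ihf p fun j hj hj' => h j hj (hj'.trans_le h₂)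
    obtain ⟨τ⟩ := ihg (p.extend f) fun j hj hj' => h j (h₁.trans hj) hj'
    exact ⟨(ofPath G K p).mergeAssocInv f g ≫ State.mergeMap σ (𝟙 g) ≫ τ⟩

/-- The first edge of `f` opens a new term and the later ones extend it. Without an edge there would
be nothing to open the term, hence `hf`. -/
theorem nonempty_cut_hom (p : EdgePath a b) (f : b ⟶ c) (hK : p.length ∈ K)
    (hf : p.length < (p.extend f).length)
    (h : ∀ j, p.length < j → j < (p.extend f).length → j ∉ K) :
    Nonempty ((ofPath G K p).cut f ⟶ ofPath G K (p.extend f)) := by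
  induction f using FreeBicategory.hom_induction with
  | of e =>
    exact ⟨eqToHom (if_pos hK).symm⟩
  | id => exact absurd hf (lt_irrefl _)
  | comp f g ihf ihg =>
    have h₁ := length_le_extend p f
    have h₂ := length_le_extend (p.extend f) g
    rcases h₁.eq_or_lt with h₃ | h₃
    -- Here `f` has no edges, so the cut happens inside `g`, and `f ≫ g` is first contracted to `g`.
    · obtain ⟨rfl, ⟨η⟩⟩ := eq_and_nonempty_of_length_eq p f h₃.symm
      have hp : p.extend f = p := EdgePath.extend_congr p η
      change p.length < ((p.extend f).extend g).length at hf
      change ∀ j, _ → j < ((p.extend f).extend g).length → _ at h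
      change Nonempty (_ ⟶ ofPath G K ((p.extend f).extend g))
      rw [hp] at hf h ⊢
      obtain ⟨σ⟩ := ihg p hK hf h
      exact ⟨(ofPath G K p).cutMap (η ▷ g ≫ (λ_ g).hom) ≫ σ⟩
    · obtain ⟨σ⟩ := ihf p hK h₃ fun j hj hj' => h j hj (hj'.trans_le h₂)
      obtain ⟨τ⟩ := nonempty_merge_hom (G := G) (K := K) (p.extend f) g
        fun j hj hj' => h j (h₃.trans_le hj) hj'
      exact ⟨(ofPath G K p).cutMerge f g ≫ State.mergeMap σ (𝟙 g) ≫ τ⟩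

/-! ### Values, underlying strings and admissibility of words -/

variable (G)

/-- The values of the terms `F(f)` for a lax functor on a free bicategory. -/
def atoms : FreeBicategory B ⥤q X where
  obj a := G.obj a
  map f := G.map f

/-- The values of formal composites of terms `F(f)`. -/
def wordValue {a b : FreeBicategory B} (f : Word a b) : G.obj a ⟶ G.obj b :=
  FreeBicategory.liftHom (atoms G) f

/-- The values of the generating 2-cells for a normal lax functor on a free bicategory. -/
noncomputable def genCell [G.IsNormal] : ∀ {a b : FreeBicategory B} {f g : Word a b},
    Gen a b f g → (wordValue G f ⟶ wordValue G g)
  | _, _, _, _, .map₂ η => G.map₂ η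
  | _, _, _, _, .mapId a => G.mapId a
  | _, _, _, _, .mapIdInv a => G.mapIdInv a
  | _, _, _, _, .mapComp f g => G.mapComp f g

/-- The values of formal 2-cells for a normal lax functor on a free bicategory. -/
noncomputable def value [G.IsNormal] {a b : FreeBicategory B} {f g : Word a b}
    (η : Cell Gen f g) : wordValue G f ⟶ wordValue G g :=
  Presentation.evalCell (P := ⟨Gen, Rel⟩) (atoms G) (genCell G) η

/-- Remove all occurrences of `F` from a formal composite. -/
def flatten {a b : FreeBicategory B} (f : Word a b) : a ⟶ b :=
  FreeBicategory.liftHom (𝟭q (FreeBicategory B)) f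

def flattenGen : ∀ {a b : FreeBicategory B} {f g : Word a b}, Gen a b f g → (flatten f ⟶ flatten g)
  | _, _, _, _, .map₂ η => η
  | _, _, _, _, .mapId a => 𝟙 (𝟙 a)
  | _, _, _, _, .mapIdInv a => 𝟙 (𝟙 a)
  | _, _, _, _, .mapComp f g => 𝟙 (f ≫ g)

def flattenCell {a b : FreeBicategory B} {f g : Word a b} (η : Cell Gen f g) :
    flatten f ⟶ flatten g :=
  Presentation.evalCell (P := ⟨Gen, Rel⟩) (𝟭q (FreeBicategory B)) flattenGen η

/-- The path obtained from `p` by appending the edges of `f`. -/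
def append {a b c : FreeBicategory B} (p : EdgePath a b) (f : Word b c) :
    EdgePath a c :=
  p.extend (flatten f)

/-- Flattening turns a formal 2-cell into a 2-cell of the free bicategory, and those exist only
between composites of the same edges. -/
theorem append_congr {a b c : FreeBicategory B} (p : EdgePath a b) {f g : Word b c}
    (η : Cell Gen f g) : append p f = append p g :=
  EdgePath.extend_congr p (flattenCell η)

theorem length_le_append {a b c : FreeBicategory B} (p : EdgePath a b) (f : Word b c) :
    p.length ≤ (append p f).length :=
  length_le_extend p (flatten f)

/-- None of the positions in `K` lies in the interior of a term of `f` when the edges of `f` are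
appended to `p`. -/
def Admissible (K : Set ℕ) {a : FreeBicategory B} : ∀ {b c : FreeBicategory B},
    EdgePath a b → Word b c → Prop
  | _, _, p, .of f => ∀ j, p.length < j → j < (append p (ofHom f)).length → j ∉ K
  | _, _, _, .id _ => True
  | _, _, p, .comp f g => Admissible K p f ∧ Admissible K (append p f) g

/-- This is where the direction of the constraints matters: composition constraints merge terms, so
each term of the source with an edge lies inside a term of the target. -/
theorem Admissible.of_cell {K : Set ℕ} {a b c : FreeBicategory B} {f g : Word b c}
    (η : Cell Gen f g) {p : EdgePath a b} (h : Admissible K p g) : Admissible K p f := by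
  induction η with
  | gen x =>
    cases x with
    | map₂ θ =>
      intro j hj hj'
      refine h j hj ?_
      rwa [← append_congr p (.gen (.map₂ θ))]
    | mapId => trivial
    -- A term without edges has no interior positions.
    | mapIdInv => exact fun j hj hj' => absurd (hj.trans hj') (lt_irrefl _)
    | mapComp f g =>
      exact ⟨fun j hj hj' => h j hj (hj'.trans_le (length_le_append _ (ofHom g))),
        fun j hj hj' => h j ((length_le_append p (ofHom f)).trans_lt hj) hj'⟩
  | id => exact h
  | vcomp _ _ ih₁ ih₂ => exact ih₁ (ih₂ h)
  | whiskerLeft _ _ ih => exact ⟨h.1, ih h.2⟩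
  | whiskerRight f η ih =>
    refine ⟨ih h.1, ?_⟩
    rw [append_congr p η]
    exact h.2
  | associator => exact ⟨⟨h.1, h.2.1⟩, h.2.2⟩
  | associatorInv => exact ⟨h.1.1, h.1.2, h.2⟩
  | leftUnitor => exact ⟨trivial, h⟩
  | leftUnitorInv => exact h.2
  | rightUnitor => exact ⟨h, trivial⟩
  | rightUnitorInv => exact h.1

/-! ### The collapse of a word onto the normal form, and its naturality -/

variable {G} {K : Set ℕ} {a b c d : FreeBicategory B}

theorem nonempty_merge_hom_of_admissible {p : EdgePath a b} {f : b ⟶ c}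
    (h : Admissible K p (ofHom f))
    (h' : ¬ (p.length ∈ K ∧ p.length < (p.extend f).length)) :
    Nonempty ((ofPath G K p).merge f ⟶ ofPath G K (p.extend f)) := by
  refine nonempty_merge_hom p f fun j hj hj' hK => ?_
  rcases hj.eq_or_lt with rfl | hj
  · exact h' ⟨hK, hj'⟩
  · exact h j hj hj' hK

open Classical in
/-- The 2-cell which combines a term `F(f)` with a state. -/
noncomputable def collapseHom (p : EdgePath a b) (f : b ⟶ c)
    (h : Admissible K p (ofHom f)) :
    (ofPath G K p).word ≫ G.map f ⟶ (ofPath G K (p.extend f)).word :=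
  -- The second condition sends terms without edges to the merging branch even at a cut position:
  -- they add no edge, so `ofPath` opens no term for them.
  if h' : p.length ∈ K ∧ p.length < (p.extend f).length then
    State.cell (s := (ofPath G K p).cut f) (nonempty_cut_hom p f h'.1 h'.2 h).some
  else (ofPath G K p).mergeCell f ≫ State.cell (nonempty_merge_hom_of_admissible h h').some

/-- By thinness the morphism chosen in `collapseHom` may be replaced by any other, so later proofs
supply convenient ones. -/
theorem collapseHom_of_cut {p : EdgePath a b} {f : b ⟶ c}
    (h : Admissible K p (ofHom f)) (hK : p.length ∈ K)
    (hf : p.length < (p.extend f).length)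
    (σ : (ofPath G K p).cut f ⟶ ofPath G K (p.extend f)) :
    collapseHom p f h = State.cell σ :=
  (dif_pos ⟨hK, hf⟩).trans (congrArg _ (Subsingleton.elim _ _))

theorem collapseHom_of_merge {p : EdgePath a b} {f : b ⟶ c}
    (h : Admissible K p (ofHom f))
    (h' : ¬ (p.length ∈ K ∧ p.length < (p.extend f).length))
    (σ : (ofPath G K p).merge f ⟶ ofPath G K (p.extend f)) :
    collapseHom p f h = (ofPath G K p).mergeCell f ≫ State.cell σ :=
  (dif_neg h').trans (congrArg (_ ≫ State.cell ·) (Subsingleton.elim _ _))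

/-- The 2-cell which combines a formal composite with a state. -/
noncomputable def collapse : ∀ {b c : FreeBicategory B} (p : EdgePath a b) (f : Word b c),
    Admissible K p f → ((ofPath G K p).word ≫ wordValue G f ⟶
      (ofPath G K (append p f)).word)
  | _, _, p, .of f, h => collapseHom p f h
  | _, _, p, .id _, _ => (ρ_ (ofPath G K p).word).hom
  | _, _, p, .comp f g, h => (α_ _ (wordValue G f) (wordValue G g)).inv ≫
      collapse p f h.1 ▷ wordValue G g ≫ collapse (append p f) g h.2

/-- Paths obtained from the two ends of a 2-cell are equal only propositionally. Morphisms such as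
`σ` and `τ` stand in for the transports, and thinness makes their choice irrelevant. -/
theorem cell_whiskerRight_collapse {p q : EdgePath a b} (f : Word b c)
    (hp : Admissible K p f) (hq : Admissible K q f) (e : p = q)
    (σ : ofPath G K p ⟶ ofPath G K q) (τ : ofPath G K (append p f) ⟶ ofPath G K (append q f)) :
    State.cell σ ▷ wordValue G f ≫ collapse q f hq =
      collapse p f hp ≫ State.cell τ := by
  subst e
  obtain rfl : σ = 𝟙 _ := Subsingleton.elim _ _
  obtain rfl : τ = 𝟙 _ := Subsingleton.elim _ _
  rw [State.cell_id, State.cell_id, Category.comp_id, id_whiskerRight, Category.id_comp]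

/-- A 2-cell preserves the edges, so both terms fall into the same branch of `collapseHom`; the
merging branch uses naturality of the composition constraint. -/
theorem collapseHom_naturality (p : EdgePath a b) {f g : b ⟶ c} (η : f ⟶ g)
    (hf : Admissible K p (ofHom f)) (hg : Admissible K p (ofHom g))
    (σ : ofPath G K (p.extend f) ⟶ ofPath G K (p.extend g)) :
    (ofPath G K p).word ◁ G.map₂ η ≫ collapseHom p g hg = collapseHom p f hf ≫ State.cell σ := by
  have e := EdgePath.extend_congr p η
  by_cases h : p.length ∈ K ∧ p.length < (p.extend f).length
  · have h' : p.length < (p.extend g).length := by rw [← e]; exact h.2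
    rw [collapseHom_of_cut hf h.1 h.2 (nonempty_cut_hom p f h.1 h.2 hf).some,
      collapseHom_of_cut hg h.1 h' (nonempty_cut_hom p g h.1 h' hg).some,
      ← State.cell_cutMap]
    erw [State.cell_comp, State.cell_comp]
    exact congrArg _ (Subsingleton.elim _ _)
  · have h' : ¬ (p.length ∈ K ∧ p.length < (p.extend g).length) := by rw [← e]; exact h
    rw [collapseHom_of_merge hf h (nonempty_merge_hom_of_admissible hf h).some,
      collapseHom_of_merge hg h' (nonempty_merge_hom_of_admissible hg h').some,
      State.whiskerLeft_map₂_mergeCell_assoc, Category.assoc, State.cell_comp, State.cell_comp]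
    exact congrArg (_ ≫ State.cell ·) (Subsingleton.elim _ _)

theorem mapId_collapseHom (p : EdgePath a b) (h : Admissible K p (ofHom (𝟙 b)))
    (σ : ofPath G K p ⟶ ofPath G K (p.extend (𝟙 b))) :
    (ofPath G K p).word ◁ G.mapId b ≫ collapseHom p (𝟙 b) h =
      (ρ_ (ofPath G K p).word).hom ≫ State.cell σ := by
  rw [collapseHom_of_merge h (fun h => lt_irrefl _ h.2) ((ofPath G K p).mergeUnit ≫ σ),
    ← State.mapId_mergeCell, Category.assoc, Category.assoc, State.cell_comp]


/-- Naturality solved for one side. It serves to replace a term without edges by the unit. -/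
theorem collapseHom_eq (p : EdgePath a b) {f g : b ⟶ c} (η : f ⟶ g)
    (hf : Admissible K p (ofHom f)) (hg : Admissible K p (ofHom g))
    (τ : ofPath G K (p.extend g) ⟶ ofPath G K (p.extend f)) :
    collapseHom p f hf = (ofPath G K p).word ◁ G.map₂ η ≫ collapseHom p g hg ≫ State.cell τ := by
  rw [← Category.assoc, collapseHom_naturality p η hf hg
    (eqToHom (congrArg _ (EdgePath.extend_congr p η))), Category.assoc,
    State.cell_comp, Subsingleton.elim (_ ≫ _) (𝟙 _), State.cell_id, Category.comp_id]

theorem mapIdInv_collapseHom [G.IsNormal] (p : EdgePath a b) (h : Admissible K p (ofHom (𝟙 b)))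
    (σ : ofPath G K (p.extend (𝟙 b)) ⟶ ofPath G K p) :
    collapseHom p (𝟙 b) h ≫ State.cell σ =
      (ofPath G K p).word ◁ G.mapIdInv b ≫ (ρ_ (ofPath G K p).word).hom := by
  obtain ⟨τ⟩ := State.nonempty_symm σ
  have h' : (ofPath G K p).word ◁ G.mapId b ≫ collapseHom p (𝟙 b) h ≫ State.cell σ =
      (ρ_ (ofPath G K p).word).hom := by
    rw [← Category.assoc, mapId_collapseHom p h τ, Category.assoc, State.cell_comp,
      State.comp_cell_self]
  rw [← h', ← whiskerLeft_comp_assoc,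
    LaxFunctor.mapIdInv, IsIso.inv_hom_id, Bicategory.whiskerLeft_id, Category.id_comp]

/-- Compatibility with the composition constraints if the first term has no edges. -/
theorem mapComp_collapseHom_of_empty [G.IsNormal] (p : EdgePath a b) {f : b ⟶ b}
    (η : f ⟶ 𝟙 b) (g : b ⟶ c) (hf : Admissible K p (ofHom f))
    (hg : Admissible K (p.extend f) (ofHom g)) (hfg : Admissible K p (ofHom (f ≫ g)))
    (σ : ofPath G K ((p.extend f).extend g) ⟶ ofPath G K (p.extend (f ≫ g))) :
    (ofPath G K p).word ◁ G.mapComp f g ≫ collapseHom p (f ≫ g) hfg =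
      (α_ _ (G.map f) (G.map g)).inv ≫ collapseHom p f hf ▷ G.map g ≫
        collapseHom (p.extend f) g hg ≫ State.cell σ := by
  have e : p.extend f = p := EdgePath.extend_congr p η
  have h₁ : Admissible K p (ofHom (𝟙 b)) := fun j hj hj' => absurd (hj.trans hj') (lt_irrefl _)
  have h₂ : Admissible K p (ofHom g) := by rw [← e]; exact hg
  have ι : ofPath G K (p.extend (𝟙 b)) ⟶ ofPath G K p := 𝟙 (ofPath G K p)
  have κ : ofPath G K p ⟶ ofPath G K (p.extend f) := eqToHom (by rw [e])
  have τ : ofPath G K (p.extend g) ⟶ ofPath G K ((p.extend f).extend g) :=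
    eqToHom (by rw [e])
  have h₃ : State.cell κ ▷ G.map g ≫ collapseHom (p.extend f) g hg =
      collapseHom p g h₂ ≫ State.cell τ := cell_whiskerRight_collapse (ofHom g) h₂ hg e.symm κ τ
  -- The left unit axiom of `G`, with the unit constraint moved across by normality.
  have h₄ : G.mapComp f g ≫ G.map₂ (η ▷ g ≫ (λ_ g).hom) =
      (G.map₂ η ≫ G.mapIdInv b) ▷ G.map g ≫ (λ_ (G.map g)).hom := by
    rw [G.map₂_leftUnitor_hom g, PrelaxFunctor.map₂_comp, G.mapComp_naturality_left_assoc,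
      comp_whiskerRight, Category.assoc, ← comp_whiskerRight_assoc (G.mapIdInv b),
      LaxFunctor.mapIdInv, IsIso.inv_hom_id, id_whiskerRight, Category.id_comp]
  rw [collapseHom_eq p η hf h₁ (ι ≫ κ), ← State.cell_comp, ← Category.assoc (collapseHom _ _ _),
    mapIdInv_collapseHom p h₁ ι,
    collapseHom_eq p (η ▷ g ≫ (λ_ g).hom) hfg h₂ (τ ≫ σ), ← Category.assoc,
    ← Bicategory.whiskerLeft_comp, h₄, ← State.cell_comp]
  simp only [comp_whiskerRight, Category.assoc, Bicategory.whiskerLeft_comp]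
  rw [reassoc_of% h₃]
  simp

/-- If `f` has no edges this is the left unit axiom. Otherwise `g` is always merged: when `f` is
cut, merging `g` is the composition constraint itself, and when `f` is merged, the claim is the
associativity axiom. -/
theorem mapComp_collapseHom [G.IsNormal] (p : EdgePath a b) (f : b ⟶ c) (g : c ⟶ d)
    (hf : Admissible K p (ofHom f)) (hg : Admissible K (p.extend f) (ofHom g))
    (hfg : Admissible K p (ofHom (f ≫ g)))
    (ι : ofPath G K ((p.extend f).extend g) ⟶ ofPath G K (p.extend (f ≫ g))) :
    (ofPath G K p).word ◁ G.mapComp f g ≫ collapseHom p (f ≫ g) hfg =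
      (α_ _ (G.map f) (G.map g)).inv ≫ collapseHom p f hf ▷ G.map g ≫
        collapseHom (p.extend f) g hg ≫ State.cell ι := by
  have h₁ := length_le_extend p f
  have h₂ := length_le_extend (p.extend f) g
  rcases h₁.eq_or_lt with h₃ | h₃
  · obtain ⟨rfl, ⟨η⟩⟩ := eq_and_nonempty_of_length_eq p f h₃.symm
    exact mapComp_collapseHom_of_empty p η g hf hg hfg ι
  -- If `g` has an edge, the end of `f` is interior to the term `f ≫ g`, so admissibility excludes
  -- it from `K`.
  have h₄ : ¬ ((p.extend f).length ∈ K ∧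
      (p.extend f).length < ((p.extend f).extend g).length) :=
    fun h => hfg _ h₃ h.2 h.1
  obtain ⟨τ⟩ := nonempty_merge_hom_of_admissible (G := G) hg h₄
  rw [collapseHom_of_merge hg h₄ τ]
  by_cases hK : p.length ∈ K
  · obtain ⟨σ⟩ := nonempty_cut_hom (G := G) p f hK h₃ hf
    rw [collapseHom_of_cut hf hK h₃ σ, collapseHom_of_cut hfg hK (h₃.trans_le h₂)
      ((ofPath G K p).cutMerge f g ≫ State.mergeMap σ (𝟙 g) ≫ τ ≫ ι), Category.assoc,
      State.cell_comp]
    rw [State.mapComp_cell_cutMerge, ← State.cell_comp]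
    exact congrArg ((α_ _ (G.map f) (G.map g)).inv ≫ ·)
      (State.cell_whiskerRight_mergeCell_assoc σ g (State.cell (τ ≫ ι))).symm
  · obtain ⟨σ⟩ := nonempty_merge_hom_of_admissible (G := G) hf (fun h => hK h.1)
    rw [collapseHom_of_merge hf (fun h => hK h.1) σ, collapseHom_of_merge hfg (fun h => hK h.1)
      ((ofPath G K p).mergeAssocInv f g ≫ State.mergeMap σ (𝟙 g) ≫ τ ≫ ι),
      comp_whiskerRight, Category.assoc, Category.assoc,
      State.cell_whiskerRight_mergeCell_assoc, State.cell_comp, State.cell_comp]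
    have h := State.mergeCell_mergeCell (ofPath G K p) f g
    rw [← Iso.inv_comp_eq] at h
    rw [← reassoc_of% h, State.cell_comp]
    exact congrArg (_ ≫ _ ≫ _ ≫ State.cell ·) (Subsingleton.elim _ _)

/-- The generators are the preceding lemmas, and the structural cells are coherence in `X`. The
right-hand side depends on `η` only through its source and target, which is what forces uniqueness.
-/
theorem collapse_naturality [G.IsNormal] {f g : Word b c} (η : Cell Gen f g)
    (p : EdgePath a b) (hf : Admissible K p f) (hg : Admissible K p g)
    (σ : ofPath G K (append p f) ⟶ ofPath G K (append p g)) :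
    (ofPath G K p).word ◁ value G η ≫ collapse p g hg = collapse p f hf ≫ State.cell σ := by
  induction η with
  | gen x =>
    cases x with
    | map₂ θ => exact collapseHom_naturality p θ hf hg σ
    | mapId => exact mapId_collapseHom p hg σ
    | mapIdInv => exact (mapIdInv_collapseHom p hf σ).symm
    | mapComp f g =>
      exact (mapComp_collapseHom p f g hf.1 hf.2 hg σ).trans
        ((congrArg (_ ≫ ·) (Category.assoc _ _ _).symm).trans (Category.assoc _ _ _).symm)
  | id f =>
    obtain rfl : σ = 𝟙 _ := Subsingleton.elim _ _
    change _ ◁ 𝟙 (wordValue G f) ≫ _ = _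
    rw [State.cell_id, Category.comp_id, Bicategory.whiskerLeft_id, Category.id_comp]
  | @vcomp b c f g h η θ ih₁ ih₂ =>
    -- The intermediate word must be admissible too; this is pulled back from the target along `θ`.
    have hg' := Admissible.of_cell θ hg
    have σ₁ : ofPath G K (append p f) ⟶ ofPath G K (append p g) :=
      eqToHom (by rw [append_congr p η])
    have σ₂ : ofPath G K (append p g) ⟶ ofPath G K (append p h) :=
      eqToHom (by rw [append_congr p θ])
    obtain rfl : σ = σ₁ ≫ σ₂ := Subsingleton.elim _ _
    change _ ◁ (value G η ≫ value G θ) ≫ _ = _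
    rw [Bicategory.whiskerLeft_comp, Category.assoc, ih₂ p hg' hg σ₂,
      ← Category.assoc, ih₁ p hf hg' σ₁, Category.assoc, State.cell_comp]
  | @whiskerLeft b c d f g h η ih =>
    obtain ⟨hf₁, hf₂⟩ := hf
    obtain ⟨hg₁, hg₂⟩ := hg
    change ofPath G K (append (append p f) g) ⟶ ofPath G K (append (append p f) h) at σ
    change _ ◁ (wordValue G f ◁ value G η) ≫ (α_ _ (wordValue G f) (wordValue G h)).inv ≫
      collapse p f hg₁ ▷ wordValue G h ≫ collapse (append p f) h hg₂ =
      ((α_ _ (wordValue G f) (wordValue G g)).inv ≫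
      collapse p f hf₁ ▷ wordValue G g ≫ collapse (append p f) g hf₂) ≫ State.cell σ
    rw [associator_inv_naturality_right_assoc, whisker_exchange_assoc, ih _ hf₂ hg₂ σ]
    simp
  | @whiskerRight b c d f g h η ih =>
    obtain ⟨hf₁, hf₂⟩ := hf
    obtain ⟨hg₁, hg₂⟩ := hg
    have σ₁ : ofPath G K (append p f) ⟶ ofPath G K (append p g) :=
      eqToHom (by rw [append_congr p η])
    change ofPath G K (append (append p f) h) ⟶ ofPath G K (append (append p g) h) at σ
    change _ ◁ (value G η ▷ wordValue G h) ≫ (α_ _ (wordValue G g) (wordValue G h)).inv ≫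
      collapse p g hg₁ ▷ wordValue G h ≫ collapse (append p g) h hg₂ =
      ((α_ _ (wordValue G f) (wordValue G h)).inv ≫
      collapse p f hf₁ ▷ wordValue G h ≫ collapse (append p f) h hf₂) ≫ State.cell σ
    rw [associator_inv_naturality_middle_assoc, ← comp_whiskerRight_assoc, ih _ hf₁ hg₁ σ₁,
      comp_whiskerRight, Category.assoc,
      cell_whiskerRight_collapse h hf₂ hg₂ (append_congr p η) σ₁ σ]
    simp
  | associator f g h =>
    obtain ⟨hg₁, hg₂, hg₃⟩ := hg
    -- Appending is associative and unital by definition, so `σ` is an endomorphism here and drops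
    -- out.
    refine Eq.trans ?_ (State.comp_cell_self _ σ).symm
    change _ ◁ (α_ (wordValue G f) (wordValue G g) (wordValue G h)).hom ≫
      (α_ _ (wordValue G f) (wordValue G g ≫ wordValue G h)).inv ≫
      collapse p f hg₁ ▷ (wordValue G g ≫ wordValue G h) ≫
        (α_ _ (wordValue G g) (wordValue G h)).inv ≫
          collapse (append p f) g hg₂ ▷ wordValue G h ≫
            collapse (append (append p f) g) h hg₃ =
      (α_ _ (wordValue G f ≫ wordValue G g) (wordValue G h)).inv ≫
      ((α_ _ (wordValue G f) (wordValue G g)).inv ≫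
      collapse p f hg₁ ▷ wordValue G g ≫ collapse (append p f) g hg₂) ▷ wordValue G h ≫
        collapse (append (append p f) g) h hg₃
    simp
  | associatorInv f g h =>
    obtain ⟨hf₁, hf₂, hf₃⟩ := hf
    refine Eq.trans ?_ (State.comp_cell_self _ σ).symm
    change _ ◁ (α_ (wordValue G f) (wordValue G g) (wordValue G h)).inv ≫
      (α_ _ (wordValue G f ≫ wordValue G g) (wordValue G h)).inv ≫
      ((α_ _ (wordValue G f) (wordValue G g)).inv ≫
      collapse p f hf₁ ▷ wordValue G g ≫ collapse (append p f) g hf₂) ▷ wordValue G h ≫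
        collapse (append (append p f) g) h hf₃ =
      (α_ _ (wordValue G f) (wordValue G g ≫ wordValue G h)).inv ≫
      collapse p f hf₁ ▷ (wordValue G g ≫ wordValue G h) ≫
        (α_ _ (wordValue G g) (wordValue G h)).inv ≫
          collapse (append p f) g hf₂ ▷ wordValue G h ≫
            collapse (append (append p f) g) h hf₃
    simp
  | leftUnitor f =>
    refine Eq.trans ?_ (State.comp_cell_self _ σ).symm
    change _ ◁ (λ_ (wordValue G f)).hom ≫ collapse p f hg =
      (α_ _ (𝟙 _) (wordValue G f)).inv ≫ (ρ_ _).hom ▷ wordValue G f ≫ collapse p f hg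
    simp
  | leftUnitorInv f =>
    refine Eq.trans ?_ (State.comp_cell_self _ σ).symm
    change _ ◁ (λ_ (wordValue G f)).inv ≫
      (α_ _ (𝟙 _) (wordValue G f)).inv ≫ (ρ_ _).hom ▷ wordValue G f ≫ collapse p f hf =
        collapse p f hf
    simp
  | rightUnitor f =>
    refine Eq.trans ?_ (State.comp_cell_self _ σ).symm
    change _ ◁ (ρ_ (wordValue G f)).hom ≫ collapse p f hg =
      (α_ _ (wordValue G f) (𝟙 _)).inv ≫ collapse p f hg ▷ 𝟙 _ ≫ (ρ_ _).hom
    simp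
  | rightUnitorInv f =>
    refine Eq.trans ?_ (State.comp_cell_self _ σ).symm
    change _ ◁ (ρ_ (wordValue G f)).inv ≫
      (α_ _ (wordValue G f) (𝟙 _)).inv ≫ collapse p f hf ▷ 𝟙 _ ≫ (ρ_ _).hom = collapse p f hf
    simp


/-! ### Cutting at the terms of the target: invertibility and uniqueness -/

/-- The positions at which the terms of `f` start when the edges of `f` are appended to `p`. -/
def cuts {a : FreeBicategory B} : ∀ {b c : FreeBicategory B}, EdgePath a b → Word b c → Set ℕ
  | _, _, p, .of _ => {p.length}
  | _, _, _, .id _ => ∅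
  | _, _, p, .comp f g => cuts p f ∪ cuts (append p f) g

/-- The upper bound is not strict because a final term without edges starts at the end of the path.
-/
theorem le_and_le_of_mem_cuts (p : EdgePath a b) (f : Word b c) {j : ℕ} (hj : j ∈ cuts p f) :
    p.length ≤ j ∧ j ≤ (append p f).length := by
  induction f with
  | of f => exact ⟨ge_of_eq hj, (le_of_eq hj).trans (length_le_append p (ofHom f))⟩
  | id => exact hj.elim
  | comp f g ihf ihg =>
    have h₁ := length_le_append p f
    have h₂ := length_le_append (append p f) g
    rcases hj with hj | hj
    · exact ⟨(ihf p hj).1, (ihf p hj).2.trans h₂⟩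
    · exact ⟨h₁.trans (ihg _ hj).1, (ihg _ hj).2⟩

theorem admissible_of_forall_mem_cuts (p : EdgePath a b) (f : Word b c)
    (h : ∀ j ∈ K, p.length < j → j < (append p f).length → j ∈ cuts p f) : Admissible K p f := by
  induction f with
  | of f => exact fun j hj hj' hK => hj.ne' (h j hK hj hj')
  | id => trivial
  | comp f g ihf ihg =>
    have h₁ := length_le_append p f
    have h₂ := length_le_append (append p f) g
    refine ⟨ihf p fun j hK hj hj' => ?_, ihg _ fun j hK hj hj' => ?_⟩
    · rcases h j hK hj (hj'.trans_le h₂) with h | h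
      · exact h
      · exact absurd (le_and_le_of_mem_cuts _ _ h).1 (not_le_of_gt hj')
    · rcases h j hK (h₁.trans_lt hj) hj' with h | h
      · exact absurd (le_and_le_of_mem_cuts _ _ h).2 (not_le_of_gt hj)
      · exact h

instance {s t : State G a b} (σ : s ⟶ t) : IsIso (State.cell σ) := by
  obtain ⟨τ⟩ := State.nonempty_symm σ
  exact ⟨State.cell τ, by rw [State.cell_comp, Subsingleton.elim (σ ≫ τ) (𝟙 s), State.cell_id],
    by rw [State.cell_comp, Subsingleton.elim (τ ≫ σ) (𝟙 t), State.cell_id]⟩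

/-- At a cut position a term with edges opens a new term, so only an invertible cell between states
occurs. A term without edges is absorbed by the inverse unit constraint, which is invertible by
normality. -/
theorem isIso_collapseHom [G.IsNormal] (p : EdgePath a b) (f : b ⟶ c)
    (h : Admissible K p (ofHom f)) (hK : p.length ∈ K) :
    IsIso (collapseHom (G := G) p f h) := by
  rcases (length_le_extend p f).eq_or_lt with hf | hf
  · obtain ⟨rfl, ⟨η⟩⟩ := eq_and_nonempty_of_length_eq p f hf.symm
    have h₁ : Admissible K p (ofHom (𝟙 c)) := fun j hj hj' => absurd (hj.trans hj') (lt_irrefl _)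
    have ι : ofPath G K (p.extend (𝟙 c)) ⟶ ofPath G K p := 𝟙 (ofPath G K p)
    have κ : ofPath G K p ⟶ ofPath G K (p.extend f) :=
      eqToHom (by rw [p.extend_congr η]; rfl)
    have := FreeBicategory.isIso₂ η
    have : IsIso (G.map₂ η) := inferInstanceAs (IsIso ((G.mapFunctor _ _).map η))
    have : IsIso (G.mapIdInv c) := by unfold LaxFunctor.mapIdInv; infer_instance
    rw [collapseHom_eq p η h h₁ (ι ≫ κ), ← State.cell_comp, ← Category.assoc (collapseHom _ _ _),
      mapIdInv_collapseHom p h₁ ι]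
    infer_instance
  · obtain ⟨σ⟩ := nonempty_cut_hom (G := G) p f hK hf h
    rw [collapseHom_of_cut h hK hf σ]
    exact inferInstanceAs (IsIso (State.cell σ))

theorem isIso_collapse [G.IsNormal] (p : EdgePath a b) (f : Word b c) (h : Admissible K p f)
    (hK : cuts p f ⊆ K) : IsIso (collapse (G := G) p f h) := by
  induction f with
  | of f => exact isIso_collapseHom p f h (hK rfl)
  | id => exact inferInstanceAs (IsIso (ρ_ (ofPath G K p).word).hom)
  | comp f g ihf ihg =>
    obtain ⟨h₁, h₂⟩ := h
    have := ihf p h₁ (Set.subset_union_left.trans hK)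
    have := ihg (append p f) h₂ (Set.subset_union_right.trans hK)
    exact inferInstanceAs (IsIso ((α_ _ (wordValue G f) (wordValue G g)).inv ≫
      collapse p f h₁ ▷ wordValue G g ≫ collapse (append p f) g h₂))

/-- The exchange law transports the equation from `e` to `𝟙 x`, where whiskering is conjugation by
unitors. -/
theorem whiskerLeft_injective_of_iso {x y : X} {e : x ⟶ x} (i : e ≅ 𝟙 x) {f g : x ⟶ y}
    {η θ : f ⟶ g} (h : e ◁ η = e ◁ θ) : η = θ := by
  have h' : 𝟙 x ◁ η = 𝟙 x ◁ θ := by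
    rw [← cancel_epi (i.hom ▷ f), ← whisker_exchange, ← whisker_exchange, h]
  simpa using h'

/-- Any two parallel formal 2-cells have the same value for a normal lax functor on a free
bicategory. -/
theorem value_eq [G.IsNormal] {f g : Word a b} (η θ : Cell Gen f g) :
    value G η = value G θ := by
  let p : EdgePath a a := Quiver.Path.nil
  have hg : Admissible (cuts p g) p g := admissible_of_forall_mem_cuts p g fun _ h _ _ => h
  have hf := Admissible.of_cell η hg
  have σ : ofPath G (cuts p g) (append p f) ⟶ ofPath G (cuts p g) (append p g) :=
    eqToHom (by rw [append_congr p η])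
  have := isIso_collapse (G := G) p g hg subset_rfl
  -- The normal form of the empty path is `𝟙 _ ≫ G.map (𝟙 a)`, which is a unit only up to the unit
  -- constraint.
  have i : (ofPath G (cuts p g) p).word ≅ 𝟙 (G.obj a) :=
    λ_ (G.map (𝟙 a)) ≪≫ (asIso (G.mapId a)).symm
  refine whiskerLeft_injective_of_iso i ?_
  rw [← cancel_mono (collapse p g hg), collapse_naturality η p hf hg σ,
    collapse_naturality θ p hf hg σ]

end Coherence

/-! ### Transfer to the comparison functor of a normal lax functor -/

section Comparison

variable {C : Type u₁} [Bicategory.{w₁, v₁} C] {D : Type u₂} [Bicategory.{w₂, v₂} D]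
  (F : C ⥤ᴸ D)

instance [F.IsNormal] : ((counit C).toLax.comp F).IsNormal where
  isIso_mapId a :=
    have : IsIso (F.map₂ (𝟙 (𝟙 ((counit C).obj a)))) := by
      rw [PrelaxFunctor.map₂_id]; infer_instance
    inferInstanceAs (IsIso (F.mapId ((counit C).obj a) ≫ F.map₂ (𝟙 (𝟙 ((counit C).obj a)))))

theorem evalGen_eq_genCell [F.IsNormal] {a b : FreeBicategory C} {f g : Word a b}
    (x : Gen a b f g) : evalGen F x = genCell ((counit C).toLax.comp F) x := by
  have h (a : C) : F.mapId a = ((counit C).toLax.comp F).mapId a :=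
    ((congrArg (F.mapId a ≫ ·) (F.map₂_id _)).trans (Category.comp_id _)).symm
  have inv_congr {x y : D} {f g : x ⟶ y} {η θ : f ⟶ g} (hη : IsIso η) (hθ : IsIso θ) (e : η = θ) :
      inv η = inv θ := by subst e; rfl
  have h' (a : C) : F.mapIdInv a = ((counit C).toLax.comp F).mapIdInv a :=
    inv_congr (LaxFunctor.IsNormal.isIso_mapId (F := F) a)
      (LaxFunctor.IsNormal.isIso_mapId (F := (counit C).toLax.comp F) a) (h a)
  cases x with
  | map₂ => rfl
  | mapId => exact h _
  | mapIdInv => exact h' _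
  | mapComp f g =>
    exact ((congrArg (F.mapComp _ _ ≫ ·) (F.map₂_id _)).trans (Category.comp_id _)).symm

/-- On formal 2-cells the comparison functor computes `value` for the composite of `F` with the
counit, so `value_eq` applies. -/
theorem comparison_map₂_eq [F.IsNormal] {a b : FreeNormalLax C} {f g : a ⟶ b} (η θ : f ⟶ g) :
    (comparison F).map₂ η = (comparison F).map₂ θ := by
  rcases η with ⟨η⟩
  rcases θ with ⟨θ⟩
  have h (η : Cell Gen f g) : Presentation.evalCell (P := ⟨Gen, Rel⟩) (evalAtom F) (evalGen F) η =
      value ((counit C).toLax.comp F) η := by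
    have : @evalGen C _ D _ F _ = @genCell C _ D _ ((counit C).toLax.comp F) _ := by
      funext a b f g x
      exact evalGen_eq_genCell F x
    rw [this]
    rfl
  exact (h η).trans ((value_eq η θ).trans (h θ).symm)

end Comparison

end FreeNormalLax

/-! ### From parallel 2-cells to diagrams -/

section Diagrams

variable {J : Type u₃} [Quiver.{v₃} J]

theorem composePath_mapPath_comp {E : Type u₁} [Category.{v₁} E] {E' : Type u₂} [Category.{v₂} E']
    (K : J ⥤q E) (M : E ⥤ E') {i j : J} (p : Quiver.Path i j) :
    composePath ((K ⋙q M.toPrefunctor).mapPath p) = M.map (composePath (K.mapPath p)) := by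
  induction p with
  | nil => exact (M.map_id _).symm
  | cons p e ih => exact (congrArg (· ≫ _) ih).trans (M.map_comp _ _).symm

theorem diagramCommutes_of_map₂_eq {N : Type u₁} [Bicategory.{w₁, v₁} N] {D : Type u₂}
    [Bicategory.{w₂, v₂} D] (P : StrictPseudofunctor N D)
    (h : ∀ {a b : N} {f g : a ⟶ b} (η θ : f ⟶ g), P.map₂ η = P.map₂ θ) (K : J ⥤q TwoCells N) :
    DiagramCommutes (K ⋙q (mapTwoCells P).toPrefunctor) := by
  have h' {x y : TwoCells N} (η θ : x ⟶ y) : (mapTwoCells P).map η = (mapTwoCells P).map θ := by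
    rcases η with ⟨η⟩
    rcases θ with ⟨θ⟩
    exact congrArg (Sigma.incl (C := fun q : D × D => (q.1 ⟶ q.2)) _).map (h η θ)
  intro i j p q
  rw [composePath_mapPath_comp, composePath_mapPath_comp]
  exact h' _ _

end Diagrams

/-! ### The oplax case by reversing 2-cells -/

/-- The bicategory obtained from `X` by reversing the 2-cells. -/
def Co (X : Type u) : Type u := X

namespace Co

variable {X : Type u} [Bicategory.{w, v} X]

instance : CategoryStruct (Co X) := inferInstanceAs (CategoryStruct X)

/-- An object of `Co X`, as an object of `X`. -/
def obj (a : Co X) : X := a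

/-- A 1-cell of `Co X`, as a 1-cell of `X`. -/
def un {a b : Co X} (f : a ⟶ b) : obj a ⟶ obj b := f

instance (a b : Co X) : Category (a ⟶ b) where
  Hom f g := un g ⟶ un f
  id f := 𝟙 (un f)
  comp η θ := CategoryStruct.comp (obj := obj a ⟶ obj b) θ η
  id_comp η := Category.comp_id (obj := obj a ⟶ obj b) η
  comp_id η := Category.id_comp (obj := obj a ⟶ obj b) η
  assoc η θ ι := (Category.assoc (obj := obj a ⟶ obj b) ι θ η).symm

/-- A 2-cell of `Co X`, as a 2-cell of `X`. -/
def un₂ {a b : Co X} {f g : a ⟶ b} (η : f ⟶ g) : un g ⟶ un f := η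

/-- An invertible 2-cell of `X`, as an invertible 2-cell of `Co X` in the same direction. -/
def iso {a b : Co X} {f g : a ⟶ b} (e : un f ≅ un g) : f ≅ g where
  hom := e.inv
  inv := e.hom
  hom_inv_id := e.hom_inv_id
  inv_hom_id := e.inv_hom_id

instance : Bicategory (Co X) where
  whiskerLeft f _ _ η := un f ◁ un₂ η
  whiskerRight η h := un₂ η ▷ un h
  homCategory := inferInstance
  associator f g h := iso (f := (f ≫ g) ≫ h) (g := f ≫ g ≫ h) (α_ (un f) (un g) (un h))
  leftUnitor f := iso (f := 𝟙 _ ≫ f) (g := f) (λ_ (un f))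
  rightUnitor f := iso (f := f ≫ 𝟙 _) (g := f) (ρ_ (un f))
  whiskerLeft_id f g := Bicategory.whiskerLeft_id (un f) (un g)
  whiskerLeft_comp f _ _ _ η θ := Bicategory.whiskerLeft_comp (un f) (un₂ θ) (un₂ η)
  id_whiskerLeft η := (Bicategory.id_whiskerLeft (un₂ η)).trans (Category.assoc _ _ _).symm
  comp_whiskerLeft f g _ _ η :=
    (Bicategory.comp_whiskerLeft (un f) (un g) (un₂ η)).trans (Category.assoc _ _ _).symm
  id_whiskerRight f g := Bicategory.id_whiskerRight (un f) (un g)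
  comp_whiskerRight η θ i := Bicategory.comp_whiskerRight (un₂ θ) (un₂ η) (un i)
  whiskerRight_id η := (Bicategory.whiskerRight_id (un₂ η)).trans (Category.assoc _ _ _).symm
  whiskerRight_comp η g h :=
    (Bicategory.whiskerRight_comp (un₂ η) (un g) (un h)).trans (Category.assoc _ _ _).symm
  whisker_assoc f _ _ η h :=
    (Bicategory.whisker_assoc (un f) (un₂ η) (un h)).trans (Category.assoc _ _ _).symm
  whisker_exchange η θ := (Bicategory.whisker_exchange (un₂ η) (un₂ θ)).symm
  pentagon f g h i :=
    (Category.assoc _ _ _).trans (Bicategory.pentagon_inv (un f) (un g) (un h) (un i))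
  triangle f g := Bicategory.triangle_assoc_comp_left_inv (un f) (un g)

end Co

namespace FreeNormalOplax

section Dual

variable {B : Type u} [Quiver.{v} B] {X : Type u₂} [Bicategory.{w₂, v₂} X]

/-- The inverse of a 2-cell of a free bicategory. -/
noncomputable def inv₂ {a b : FreeBicategory B} {f g : a ⟶ b} (η : f ⟶ g) : g ⟶ f :=
  have := FreeBicategory.isIso₂ η
  inv η

/-- An oplax functor on a free bicategory, seen as a lax functor to the bicategory with reversed
2-cells. -/
noncomputable def toCo (G : FreeBicategory B ⥤ᵒᵖᴸ X) : FreeBicategory B ⥤ᴸ Co X where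
  obj a := (G.obj a : X)
  map f := G.map f
  -- Reversal makes `G.map₂` contravariant; inverting 2-cells in the free bicategory restores
  -- covariance.
  map₂ η := G.map₂ (inv₂ η)
  map₂_id f := (congrArg _ (Subsingleton.elim _ _)).trans (G.map₂_id f)
  map₂_comp η θ := (congrArg _ (Subsingleton.elim _ _)).trans (G.map₂_comp (inv₂ θ) (inv₂ η))
  mapId a := G.mapId a
  mapComp f g := G.mapComp f g
  mapComp_naturality_left η g :=
    (congrArg (G.map₂ · ≫ _) (Subsingleton.elim _ _)).trans (G.mapComp_naturality_left (inv₂ η) g)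
  mapComp_naturality_right f _ _ η :=
    (congrArg (G.map₂ · ≫ _) (Subsingleton.elim _ _)).trans (G.mapComp_naturality_right f (inv₂ η))
  map₂_associator f g h := by
    have h₁ : G.map₂ (inv₂ (α_ f g h).hom) ≫ G.mapComp (f ≫ g) h ≫ G.mapComp f g ▷ G.map h =
        G.mapComp f (g ≫ h) ≫ G.map f ◁ G.mapComp g h ≫ (α_ _ _ _).inv := by
      rw [G.mapComp_assoc_left, ← Category.assoc, ← G.map₂_comp,
        Subsingleton.elim (inv₂ (α_ f g h).hom ≫ (α_ f g h).hom) (𝟙 _), G.map₂_id, Category.id_comp]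
    exact (Category.assoc _ _ _).trans (h₁.trans (Category.assoc _ _ _).symm)
  map₂_leftUnitor f := (congrArg G.map₂ (Subsingleton.elim _ _)).trans
    ((G.map₂_leftUnitor f).trans (Category.assoc _ _ _).symm)
  map₂_rightUnitor f := (congrArg G.map₂ (Subsingleton.elim _ _)).trans
    ((G.map₂_rightUnitor f).trans (Category.assoc _ _ _).symm)

instance (G : FreeBicategory B ⥤ᵒᵖᴸ X) [G.IsNormal] : (toCo G).IsNormal where
  isIso_mapId a := ⟨G.mapIdInv a, IsIso.inv_hom_id (G.mapId a), IsIso.hom_inv_id (G.mapId a)⟩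

/-- The generating 2-cells of the free normal lax functor which correspond to those of the free
normal oplax functor. -/
noncomputable def dualGen : ∀ {a b : FreeBicategory B} {f g : Word a b},
    Gen a b f g → FreeNormalLax.Gen a b g f
  | _, _, _, _, .map₂ η => .map₂ (inv₂ η)
  | _, _, _, _, .mapId a => .mapId a
  | _, _, _, _, .mapIdInv a => .mapIdInv a
  | _, _, _, _, .mapComp f g => .mapComp f g

noncomputable def dualCell : ∀ {a b : FreeBicategory B} {f g : Word a b},
    Cell Gen f g → Cell FreeNormalLax.Gen g f
  | _, _, _, _, .gen x => .gen (dualGen x)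
  | _, _, _, _, .id f => .id f
  | _, _, _, _, .vcomp η θ => .vcomp (dualCell θ) (dualCell η)
  | _, _, _, _, .whiskerLeft f η => .whiskerLeft f (dualCell η)
  | _, _, _, _, .whiskerRight h η => .whiskerRight h (dualCell η)
  | _, _, _, _, .associator f g h => .associatorInv f g h
  | _, _, _, _, .associatorInv f g h => .associator f g h
  | _, _, _, _, .leftUnitor f => .leftUnitorInv f
  | _, _, _, _, .leftUnitorInv f => .leftUnitor f
  | _, _, _, _, .rightUnitor f => .rightUnitorInv f
  | _, _, _, _, .rightUnitorInv f => .rightUnitor f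

end Dual

section Comparison

variable {C : Type u₁} [Bicategory.{w₁, v₁} C] {D : Type u₂} [Bicategory.{w₂, v₂} D]
  (F : C ⥤ᵒᵖᴸ D)

/-- The composite of `F` with the evaluation functor of `C`. -/
abbrev compCounit : FreeBicategory C ⥤ᵒᵖᴸ D := (counit C).toOplax.comp F

instance [F.IsNormal] : (compCounit F).IsNormal where
  isIso_mapId a :=
    have : IsIso (F.map₂ (𝟙 (𝟙 ((counit C).obj a)))) := by
      rw [PrelaxFunctor.map₂_id]; infer_instance
    inferInstanceAs (IsIso (F.map₂ (𝟙 (𝟙 ((counit C).obj a))) ≫ F.mapId ((counit C).obj a)))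

theorem evalGen_eq_genCell [F.IsNormal] {a b : FreeBicategory C} {f g : Word a b}
    (x : Gen a b f g) :
    evalGen F x = FreeNormalLax.genCell (toCo (compCounit F)) (dualGen x) := by
  have h (a : C) : F.mapId a = (compCounit F).mapId a :=
    ((congrArg (· ≫ F.mapId a) (F.map₂_id _)).trans (Category.id_comp _)).symm
  have inv_eq {x y : D} {f g : x ⟶ y} {η : f ⟶ g} (hη : IsIso η) (θ : g ⟶ f) (e : η ≫ θ = 𝟙 f) :
      inv η = θ := IsIso.inv_eq_of_hom_inv_id e
  have h' (a : C) : F.mapIdInv a = (toCo (compCounit F)).mapIdInv a :=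
    inv_eq (OplaxFunctor.IsNormal.isIso_mapId (F := F) a) _ ((congrArg (· ≫ _) (h a)).trans
      (IsIso.inv_hom_id (I := LaxFunctor.IsNormal.isIso_mapId (F := toCo (compCounit F)) a)
        ((toCo (compCounit F)).mapId a)))
  cases x with
  -- `dualGen` inverts once and `toCo` inverts again.
  | map₂ η => exact congrArg (compCounit F).map₂ (Subsingleton.elim η (inv₂ (inv₂ η)))
  | mapId => exact h _
  | mapIdInv => exact h' _
  | mapComp f g =>
    exact ((congrArg (· ≫ F.mapComp _ _) (F.map₂_id _)).trans (Category.id_comp _)).symm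

/-- Structural cells match by definition, because the associators and unitors of `Co D` are the
inverses of those of `D`; only the generators need an argument. -/
theorem evalCell_eq_value [F.IsNormal] {a b : FreeBicategory C} {f g : Word a b}
    (η : Cell Gen f g) :
    Presentation.evalCell (P := ⟨Gen, Rel⟩) (evalAtom F) (evalGen F) η =
      FreeNormalLax.value (toCo (compCounit F)) (dualCell η) := by
  induction η with
  | gen x => exact evalGen_eq_genCell F x
  | vcomp η θ ih₁ ih₂ => exact congrArg₂ (fun x y => x ≫ y) ih₁ ih₂
  | whiskerLeft f η ih => exact congrArg (fun x => FreeBicategory.liftHom (evalAtom F) f ◁ x) ih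
  | whiskerRight f η ih => exact congrArg (fun x => x ▷ FreeBicategory.liftHom (evalAtom F) f) ih
  | _ => rfl

theorem comparison_map₂_eq [F.IsNormal] {a b : FreeNormalOplax C} {f g : a ⟶ b} (η θ : f ⟶ g) :
    (comparison F).map₂ η = (comparison F).map₂ θ := by
  rcases η with ⟨η⟩
  rcases θ with ⟨θ⟩
  exact (evalCell_eq_value F η).trans
    ((FreeNormalLax.value_eq _ _).trans (evalCell_eq_value F θ).symm)

end Comparison

end FreeNormalOplax

theorem mainTheorem4 {C : Type u₁} [Bicategory.{w₁, v₁} C] {D : Type u₂} [Bicategory.{w₂, v₂} D]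
    {J : Type u₃} [Quiver.{v₃} J] (K : J ⥤q TwoCells D) :
    (∀ (F : C ⥤ᴸ D) [F.IsNormal], F.IsFormalDiagram K → DiagramCommutes K) ∧
      (∀ (F : C ⥤ᵒᵖᴸ D) [F.IsNormal], F.IsFormalDiagram K → DiagramCommutes K) := by
  constructor
  · rintro F _ ⟨K', rfl⟩
    exact diagramCommutes_of_map₂_eq _ (FreeNormalLax.comparison_map₂_eq F) K'
  · rintro F _ ⟨K', rfl⟩
    exact diagramCommutes_of_map₂_eq _ (FreeNormalOplax.comparison_map₂_eq F) K'
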